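/- Let $n\ge 0$ and let $\mu$ be Lebesgue measure on $\mathbb{R}^n$. Let $\rho\in L^1(\mu)$ satisfy $\rho\ge 0$ almost everywhere and $\int\rho\,d\mu=1$, let $P=\rho\,d\mu$, and let $L^2(P)$ be the real Hilbert space of square-integrable functions for $P$. Let $\mathbf F\colon\mathbb{R}^n\to\mathbb{R}^n$ be continuously differentiable with bounded derivative. Assume that $\rho\mathbf F\in W^{1,1}(\mathbb{R}^n)$, i.e. every component of $\rho\mathbf F$ is integrable and has integrable weak first partial derivatives, and that $$\omega_0:=\tfrac12\,\big\|\rho^{-1}\operatorname{div}(\rho\mathbf F)\big\|_{L^\infty(P)}<\infty ,$$ where $\operatorname{div}$ is the weak divergence. (The set where $\rho$ vanishes is $P$-null, so $\rho^{-1}$ is defined $P$-almost everywhere.) Let $\varphi\colon\mathbb{R}\times\mathbb{R}^n\to\mathbb{R}^n$ be the flow of $\mathbf F$: the continuous map with $\varphi_0=\mathrm{id}$, $\varphi_{t+s}=\varphi_t\circ\varphi_s$ and $\frac{d}{dt}\varphi_t(\mathbf x)=\mathbf F(\varphi_t(\mathbf x))$ for all $s,t\in\mathbb{R}$ and $\mathbf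 x\in\mathbb{R}^n$ (such a flow exists). Then the following hold. 1. The operator $\mathbf F\cdot\nabla$ with domain $C^1_c(\mathbb{R}^n)$ is closable in $L^2(P)$, and its closure is the generator of a strongly continuous group $\{\mathcal U(t)\}_{t\in\mathbb{R}}$ of bounded linear operators on $L^2(P)$. 2. $\|\mathcal U(t)\|\le e^{\omega_0|t|}$ for all $t\in\mathbb{R}$. 3. $\mathcal U(t)x=x\circ\varphi_t$ in $L^2(P)$ for all $x\in C^1_c(\mathbb{R}^n)$ and $t\in\mathbb{R}$. If in addition $\operatorname{div}(\rho\mathbf F)=0$ almost everywhere, then: 4. $\mathcal U(t)$ is a linear isometry on $L^2(P)$ for all $t\in\mathbb{R}$. 5. $P$ is invariant under $\varphi_t$ for all $t\in\mathbb{R}$, i.e. $P(\varphi_t^{-1}(M))=P(M)$ for every measurable set $M$. 6. $\mathcal U(t)x=x\circ\varphi_t$ for all $x\in L^2(P)$ and $t\in\mathbb{R}$. -/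

import Mathlib

open MeasureTheory Filter Topology
open scoped ENNReal

namespace Koopman

/-! ### Weak derivatives and `W^{1,1}(ℝⁿ)` -/

/-- `g` is the weak partial derivative `∂ᵢ f` on `ℝⁿ`, tested against `C_c^∞(ℝⁿ)`. -/
structure HasWeakPartialDeriv {n : ℕ} (i : Fin n) (f g : EuclideanSpace ℝ (Fin n) → ℝ) : Prop where
  locallyIntegrable : LocallyIntegrable f volume
  locallyIntegrable_deriv : LocallyIntegrable g volume
  integral_eq : ∀ η : EuclideanSpace ℝ (Fin n) → ℝ, ContDiff ℝ ((⊤ : ℕ∞) : WithTop ℕ∞) η → HasCompactSupport η →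
    ∫ x, f x * fderiv ℝ η x (EuclideanSpace.single i 1) = - ∫ x, g x * η x

/-- Weak partial derivatives are unique almost everywhere. -/
theorem HasWeakPartialDeriv.ae_eq {n : ℕ} {i : Fin n} {f g g' : EuclideanSpace ℝ (Fin n) → ℝ}
    (h : HasWeakPartialDeriv i f g) (h' : HasWeakPartialDeriv i f g') : g =ᵐ[volume] g' := by
  refine ae_eq_of_integral_contDiff_smul_eq h.locallyIntegrable_deriv
    h'.locallyIntegrable_deriv fun η hη hc => ?_
  have e := (h.integral_eq η hη hc).symm.trans (h'.integral_eq η hη hc)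
  simpa [mul_comm] using neg_injective e

/-- Membership of a scalar function in the Sobolev space `W^{1,1}(ℝⁿ)`. -/
def MemW11 {n : ℕ} (f : EuclideanSpace ℝ (Fin n) → ℝ) : Prop :=
  Integrable f volume ∧ ∀ i, ∃ g, Integrable g volume ∧ HasWeakPartialDeriv i f g

open scoped Classical in
/-- A representative of the weak partial derivative `∂ᵢ f` (the zero function if there is none). -/
noncomputable def weakPartialDeriv {n : ℕ} (i : Fin n) (f : EuclideanSpace ℝ (Fin n) → ℝ) :
    EuclideanSpace ℝ (Fin n) → ℝ :=
  if h : ∃ g, HasWeakPartialDeriv i f g then h.choose else 0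

/-- The weak divergence `div G = ∑ᵢ ∂ᵢ Gᵢ` of a vector field. -/
noncomputable def weakDiv {n : ℕ} (G : EuclideanSpace ℝ (Fin n) → EuclideanSpace ℝ (Fin n)) :
    EuclideanSpace ℝ (Fin n) → ℝ :=
  fun x => ∑ i, weakPartialDeriv i (fun y => G y i) x

/-! ### Strongly continuous groups and their generators -/

/-- `U` is a strongly continuous one-parameter group of bounded operators. -/
structure IsC0Group {H : Type*} [NormedAddCommGroup H] [NormedSpace ℝ H]
    (U : ℝ → H →L[ℝ] H) : Prop where
  map_zero : U 0 = 1
  map_add : ∀ s t, U (s + t) = U s * U t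
  continuous_orbit : ∀ x, Continuous fun t => U t x

/-- The generator of the group `U`: the derivative at `0` of the orbit maps `t ↦ U(t)x`, with
domain all the `x` for which this derivative exists. -/
noncomputable def generator {H : Type*} [NormedAddCommGroup H] [NormedSpace ℝ H]
    (U : ℝ → H →L[ℝ] H) : H →ₗ.[ℝ] H where
  domain :=
    { carrier := {x | DifferentiableAt ℝ (fun t => U t x) 0}
      zero_mem' := by simp
      add_mem' := fun {x y} hx hy => by
        have h := DifferentiableAt.add (f := fun t => U t x) (g := fun t => U t y) hx hy
        simpa [Pi.add_def] using h
      smul_mem' := fun c x hx => by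
        have h := DifferentiableAt.const_smul (f := fun t => U t x) hx c
        simpa [Pi.smul_def] using h }
  toFun :=
    { toFun := fun x => deriv (fun t => U t (x : H)) 0
      map_add' := fun x y => by
        have h := deriv_add (f := fun t => U t (x : H)) (g := fun t => U t (y : H)) x.2 y.2
        simpa [Pi.add_def] using h
      map_smul' := fun c x => by
        have h := deriv_const_smul (f := fun t => U t (x : H)) c x.2
        simpa [Pi.smul_def] using h }

/-! ### The operator `F · ∇` on `C¹_c(ℝⁿ)`, as an operator in `L²(P)` -/

/-- The graph `{([x], [F · ∇x]) : x ∈ C¹_c(ℝⁿ)}` in `L²(P) × L²(P)`. -/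
def advectionGraph {n : ℕ} (F : EuclideanSpace ℝ (Fin n) → EuclideanSpace ℝ (Fin n))
    (P : Measure (EuclideanSpace ℝ (Fin n))) : Submodule ℝ (Lp ℝ 2 P × Lp ℝ 2 P) where
  carrier := {p | ∃ x : EuclideanSpace ℝ (Fin n) → ℝ, ContDiff ℝ 1 x ∧ HasCompactSupport x ∧
    p.1 =ᵐ[P] x ∧ p.2 =ᵐ[P] fun ω => fderiv ℝ x ω (F ω)}
  zero_mem' := by
    refine ⟨fun _ => 0, contDiff_const, HasCompactSupport.zero, Lp.coeFn_zero _ _ _, ?_⟩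
    filter_upwards [Lp.coeFn_zero ℝ 2 P] with ω h
    simpa using h
  add_mem' := by
    rintro p q ⟨x, hx, cx, h1, h2⟩ ⟨y, hy, cy, k1, k2⟩
    refine ⟨x + y, hx.add hy, cx.add cy, ?_, ?_⟩
    · exact (Lp.coeFn_add p.1 q.1).trans (h1.add k1)
    · refine (Lp.coeFn_add p.2 q.2).trans ((h2.add k2).trans (ae_of_all _ fun ω => ?_))
      simp [fderiv_add (hx.differentiable one_ne_zero ω) (hy.differentiable one_ne_zero ω)]
  smul_mem' := by
    rintro c p ⟨x, hx, cx, h1, h2⟩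
    refine ⟨c • x, contDiff_const.smul hx, cx.smul_left (f := fun _ => c), ?_, ?_⟩
    · exact (Lp.coeFn_smul c p.1).trans (h1.const_smul c)
    · refine (Lp.coeFn_smul c p.2).trans ((h2.const_smul c).trans (ae_of_all _ fun ω => ?_))
      simp [fderiv_const_smul (hx.differentiable one_ne_zero ω)]

/-- The operator `F · ∇` with domain `C¹_c(ℝⁿ)` in `L²(P)`. -/
noncomputable def advection {n : ℕ} (F : EuclideanSpace ℝ (Fin n) → EuclideanSpace ℝ (Fin n))
    (P : Measure (EuclideanSpace ℝ (Fin n))) : Lp ℝ 2 P →ₗ.[ℝ] Lp ℝ 2 P :=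
  (advectionGraph F P).toLinearPMap

/-- The derivative of a `C¹` function vanishes almost everywhere on its zero set. -/
theorem ae_fderiv_eq_zero_of_eq_zero {n : ℕ} {x : EuclideanSpace ℝ (Fin n) → ℝ}
    (hx : ContDiff ℝ 1 x) : ∀ᵐ ω, x ω = 0 → fderiv ℝ x ω = 0 := by
  rcases subsingleton_or_nontrivial (EuclideanSpace ℝ (Fin n)) with hE | hE
  · exact ae_of_all _ fun ω _ => by
      ext v; rw [Subsingleton.elim v 0]; simp
  obtain ⟨e, he⟩ := exists_ne (0 : EuclideanSpace ℝ (Fin n))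
  have hs : MeasurableSet {ω | x ω = 0} := (isClosed_eq hx.continuous continuous_const).measurableSet
  have hA : ApproximatesLinearOn (fun ω => x ω • e)
      (0 : EuclideanSpace ℝ (Fin n) →L[ℝ] EuclideanSpace ℝ (Fin n)) {ω | x ω = 0} 0 := by
    intro a ha b hb
    have ha' : x a = 0 := ha
    have hb' : x b = 0 := hb
    simp [ha', hb']
  have key := hA.norm_fderiv_sub_le volume hs (fun ω => (fderiv ℝ x ω).smulRight e) fun ω _ =>
    (((hx.differentiable one_ne_zero ω).hasFDerivAt).smul_const e).hasFDerivWithinAt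
  rw [ae_restrict_iff' hs] at key
  filter_upwards [key] with ω h hω
  simpa [he] using h hω

/-- If `P` has a density, then `F · ∇x` depends on the class of `x` only, so that `advection F P`
is a genuine operator with graph `advectionGraph F P`. -/
theorem advection_graph {n : ℕ} (F : EuclideanSpace ℝ (Fin n) → EuclideanSpace ℝ (Fin n))
    {P : Measure (EuclideanSpace ℝ (Fin n))} (hP : P ≪ volume) :
    (advection F P).graph = advectionGraph F P := by
  refine Submodule.toLinearPMap_graph_eq _ ?_
  rintro p ⟨x, hx, -, h1, h2⟩ hp
  rw [hp] at h1
  refine Lp.ext ?_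
  filter_upwards [h1, h2, Lp.coeFn_zero ℝ 2 P, hP.ae_le (ae_fderiv_eq_zero_of_eq_zero hx)]
    with ω e1 e2 e3 e4
  rw [e2, e3, e4 (by rw [← e1, e3]; rfl)]
  rfl

/-- For a finite measure `P`, every `x ∈ C¹_c(ℝⁿ)` belongs to the domain of `advection F P`. -/
theorem exists_mem_advectionGraph {n : ℕ}
    {F : EuclideanSpace ℝ (Fin n) → EuclideanSpace ℝ (Fin n)} (hF : Continuous F)
    (P : Measure (EuclideanSpace ℝ (Fin n))) [IsFiniteMeasure P]
    {x : EuclideanSpace ℝ (Fin n) → ℝ} (hx : ContDiff ℝ 1 x) (cx : HasCompactSupport x) :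
    ∃ p ∈ advectionGraph F P, p.1 =ᵐ[P] x ∧ p.2 =ᵐ[P] fun ω => fderiv ℝ x ω (F ω) := by
  have h1 : MemLp x 2 P := hx.continuous.memLp_of_hasCompactSupport cx
  have h2 : MemLp (fun ω => fderiv ℝ x ω (F ω)) 2 P := by
    refine Continuous.memLp_of_hasCompactSupport
      ((hx.continuous_fderiv one_ne_zero).clm_apply hF) ?_
    refine (cx.fderiv (𝕜 := ℝ)).mono fun ω hω h0 => hω ?_
    simp only [h0, ContinuousLinearMap.zero_apply]
  exact ⟨(h1.toLp x, h2.toLp _), ⟨x, hx, cx, h1.coeFn_toLp, h2.coeFn_toLp⟩,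
    h1.coeFn_toLp, h2.coeFn_toLp⟩

/-- The measure `P = ρ dμ` with density `ρ`. -/
noncomputable def densityMeasure {n : ℕ} (ρ : EuclideanSpace ℝ (Fin n) → ℝ) :
    Measure (EuclideanSpace ℝ (Fin n)) :=
  volume.withDensity fun x => ENNReal.ofReal (ρ x)

/-- The quantity `ρ⁻¹ div(ρF)`, up to null sets of `P = ρ dμ`. -/
noncomputable def logDiv {n : ℕ} (ρ : EuclideanSpace ℝ (Fin n) → ℝ)
    (F : EuclideanSpace ℝ (Fin n) → EuclideanSpace ℝ (Fin n)) : EuclideanSpace ℝ (Fin n) → ℝ :=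
  fun x => (ρ x)⁻¹ * weakDiv (fun y => ρ y • F y) x

end Koopman

/-!
The group is composition with the flow. That it acts on `L²(P)` follows from a bound on the image
measures `(φₜ)_* P`, and `C¹_c` determines the generator because its orbits stay in the domain of the
closure of `F · ∇`. Differentiability of the flow in the initial value is not used, only the
Lipschitz bound given by Grönwall's inequality (`lipschitzWith_flow`).

*Integration by parts.* For Lipschitz `f` of compact support, `∫ F · ∇f dP = - ∫ q f dP` with
`q = ρ⁻¹ div(ρF)` (`integral_fderiv_densityMeasure`). For the mollifications of `f` this is the
definition of the weak divergence, and their derivatives converge almost everywhere by Rademacher's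
theorem. Dividing by `ρ` is legitimate because `div(ρF) = 0` almost everywhere on `{ρ = 0}`: each
component of `ρF` vanishes there, and Stampacchia's lemma
(`HasWeakPartialDeriv.ae_eq_zero_of_eq_zero`) says that weak derivatives vanish on zero sets.

*Transport.* For `0 ≤ u ∈ C¹_c`, the function `h(t) = ∫ u ∘ φₜ dP` has the derivative
`∫ F · ∇(u ∘ φₜ) dP = - ∫ q (u ∘ φₜ) dP`, hence `|h'| ≤ ‖q‖_∞ h` and `h(t) ≤ exp(‖q‖_∞ |t|) h(0)`.
As `u` is arbitrary, `(φₜ)_* P ≤ exp(‖q‖_∞ |t|) P` (`map_flow_le`). So `U(t)x = x ∘ φₜ` is defined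
on all of `L²(P)`, with norm at most `exp(‖q‖_∞ |t| / 2)`. If `div(ρF) = 0` the constant is `1` in
both time directions, which gives the isometry and the invariance of `P`.

*The generator.* The difference quotients of `x ∘ φₜ`, `x ∈ C¹_c`, converge to `F · ∇x` by dominated
convergence, so the generator, a closed operator, extends `F · ∇`. Conversely, the closure of
`F · ∇` contains the orbits `(x ∘ φₜ, (F · ∇x) ∘ φₜ)`, because `x ∘ φₜ` is a Lipschitz function of
compact support and can be mollified (`orbit_mem_closure_advectionGraph`). A closed subspace with
this property contains the graph of the generator (`IsC0Group.mem_of_hasDerivAt`): time averages of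
orbits remain in it, and they converge in the graph norm.
-/

namespace Koopman

/-! ### Mollification -/

section Mollification

open ContinuousLinearMap Set
open scoped Convolution

/-- The radial bump function of outer radius `1 / (k + 1)` used for mollification. The ratio of its
radii is fixed, as almost everywhere convergence of mollifications requires. -/
noncomputable def mollifier (n k : ℕ) : ContDiffBump (0 : EuclideanSpace ℝ (Fin n)) where
  rIn := 1 / (k + 1) / 2
  rOut := 1 / (k + 1)
  rIn_pos := by positivity
  rIn_lt_rOut := half_lt_self (by positivity)

/-- The mollification `χₖ ⋆ f` of `f` by the normalised bump function of radius `1 / (k + 1)`. -/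
noncomputable def mollify {n : ℕ} (k : ℕ) (f : EuclideanSpace ℝ (Fin n) → ℝ) :
    EuclideanSpace ℝ (Fin n) → ℝ :=
  (mollifier n k).normed volume ⋆[lsmul ℝ ℝ, volume] f

theorem tendsto_mollifier_rOut (n : ℕ) :
    Tendsto (fun k => (mollifier n k).rOut) atTop (𝓝 0) :=
  tendsto_one_div_add_atTop_nhds_zero_nat

theorem mollifier_rOut_le_one (n k : ℕ) : (mollifier n k).rOut ≤ 1 := by
  change (1 : ℝ) / (k + 1) ≤ 1
  rw [div_le_one (by positivity)]
  linarith [(Nat.cast_nonneg k : (0 : ℝ) ≤ k)]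

variable {n : ℕ} {f g : EuclideanSpace ℝ (Fin n) → ℝ}

theorem mollify_eq_integral (k : ℕ) (f : EuclideanSpace ℝ (Fin n) → ℝ)
    (x : EuclideanSpace ℝ (Fin n)) :
    mollify k f x = ∫ y, (mollifier n k).normed volume (x - y) * f y := by
  rw [mollify, convolution_eq_swap]
  rfl

theorem convolutionExistsAt_mollify (hf : LocallyIntegrable f) (k : ℕ)
    (x : EuclideanSpace ℝ (Fin n)) :
    ConvolutionExistsAt ((mollifier n k).normed volume) f x (lsmul ℝ ℝ) volume :=
  (mollifier n k).hasCompactSupport_normed.convolutionExists_left _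
    (mollifier n k).continuous_normed hf x

theorem contDiff_mollify (hf : LocallyIntegrable f) (k : ℕ) :
    ContDiff ℝ ((⊤ : ℕ∞) : WithTop ℕ∞) (mollify k f) :=
  (mollifier n k).hasCompactSupport_normed.contDiff_convolution_left _
    (mollifier n k).contDiff_normed hf

theorem ae_tendsto_mollify (hf : LocallyIntegrable f) :
    ∀ᵐ x, Tendsto (fun k => mollify k f x) atTop (𝓝 (f x)) :=
  ContDiffBump.ae_convolution_tendsto_right_of_locallyIntegrable (K := 2)
    (tendsto_mollifier_rOut n)
    (Eventually.of_forall fun k => by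
      change (1 : ℝ) / (k + 1) ≤ 2 * (1 / (k + 1) / 2); linarith) hf

theorem tendsto_mollify (hf : Continuous f) (x : EuclideanSpace ℝ (Fin n)) :
    Tendsto (fun k => mollify k f x) atTop (𝓝 (f x)) :=
  ContDiffBump.convolution_tendsto_right_of_continuous (tendsto_mollifier_rOut n) hf x

theorem abs_mollify_le {C : ℝ} (hC : ∀ x, |f x| ≤ C) (k : ℕ) (x : EuclideanSpace ℝ (Fin n)) :
    |mollify k f x| ≤ C := by
  rw [mollify, convolution]
  calc |∫ t, (lsmul ℝ ℝ) ((mollifier n k).normed volume t) (f (x - t))|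
      ≤ ∫ t, (mollifier n k).normed volume t * C := by
        rw [← Real.norm_eq_abs]
        refine norm_integral_le_of_norm_le
          (((mollifier n k).integrable_normed (μ := volume)).mul_const C) (ae_of_all _ fun t => ?_)
        simp only [lsmul_apply, smul_eq_mul, norm_mul, Real.norm_eq_abs]
        rw [abs_of_nonneg ((mollifier n k).nonneg_normed t)]
        exact mul_le_mul_of_nonneg_left (hC _) ((mollifier n k).nonneg_normed t)
    _ = C := by rw [integral_mul_const,
        ContDiffBump.integral_normed (mollifier n k) (μ := volume), one_mul]

theorem lipschitzWith_mollify {L : NNReal} (hf : LipschitzWith L f) (k : ℕ) :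
    LipschitzWith L (mollify k f) := by
  refine LipschitzWith.of_dist_le_mul fun x y => ?_
  have hloc := hf.continuous.locallyIntegrable (μ := (volume : Measure (EuclideanSpace ℝ (Fin n))))
  rw [Real.dist_eq, mollify, convolution, convolution,
    ← integral_sub (convolutionExistsAt_mollify hloc k x) (convolutionExistsAt_mollify hloc k y)]
  calc |∫ t, ((lsmul ℝ ℝ) ((mollifier n k).normed volume t) (f (x - t)) -
          (lsmul ℝ ℝ) ((mollifier n k).normed volume t) (f (y - t)))|
      ≤ ∫ t, (mollifier n k).normed volume t * (L * dist x y) := by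
        rw [← Real.norm_eq_abs]
        refine norm_integral_le_of_norm_le
          (((mollifier n k).integrable_normed (μ := volume)).mul_const _) (ae_of_all _ fun t => ?_)
        simp only [lsmul_apply, smul_eq_mul, ← mul_sub, norm_mul, Real.norm_eq_abs]
        rw [abs_of_nonneg ((mollifier n k).nonneg_normed t), ← Real.dist_eq]
        refine mul_le_mul_of_nonneg_left ?_ ((mollifier n k).nonneg_normed t)
        simpa using hf.dist_le_mul (x - t) (y - t)
    _ = L * dist x y := by rw [integral_mul_const,
        ContDiffBump.integral_normed (mollifier n k) (μ := volume), one_mul]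

/-- Mollifications of a function supported in a ball are supported in one common ball. -/
theorem mollify_eq_zero {R : ℝ} (hf : ∀ x, R < ‖x‖ → f x = 0) (k : ℕ)
    {x : EuclideanSpace ℝ (Fin n)} (hx : R + 1 < ‖x‖) : mollify k f x = 0 := by
  rw [mollify, convolution]
  refine integral_eq_zero_of_ae (ae_of_all _ fun t => ?_)
  by_cases ht : ‖t‖ < (mollifier n k).rOut
  · have h1 := mollifier_rOut_le_one n k
    have h2 := norm_sub_norm_le x t
    simp [hf (x - t) (by linarith)]
  · have : t ∉ Function.support ((mollifier n k).normed volume) := by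
      rw [ContDiffBump.support_normed_eq]; simpa using ht
    simp [Function.notMem_support.1 this]

theorem hasCompactSupport_of_forall_norm {R : ℝ} (hf : ∀ x, R < ‖x‖ → f x = 0) :
    HasCompactSupport f :=
  HasCompactSupport.intro (isCompact_closedBall 0 R) fun x hx => hf x (by simpa using hx)

theorem exists_radius_of_hasCompactSupport (hf : HasCompactSupport f) :
    ∃ R : ℝ, ∀ x, R < ‖x‖ → f x = 0 := by
  obtain ⟨R, hR⟩ := hf.isBounded.subset_closedBall 0
  refine ⟨R, fun x hx => image_eq_zero_of_notMem_tsupport fun h => ?_⟩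
  have := hR h
  simp only [Metric.mem_closedBall, dist_zero_right] at this
  linarith

/-- Mollification commutes with weak differentiation. -/
theorem fderiv_mollify_apply {i : Fin n} (h : HasWeakPartialDeriv i f g) (k : ℕ)
    (x : EuclideanSpace ℝ (Fin n)) :
    fderiv ℝ (mollify k f) x (EuclideanSpace.single i 1) = mollify k g x := by
  set χ := (mollifier n k).normed (volume : Measure (EuclideanSpace ℝ (Fin n))) with hχ
  have hχs : ContDiff ℝ ((⊤ : ℕ∞) : WithTop ℕ∞) χ := (mollifier n k).contDiff_normed
  have hχc : HasCompactSupport χ := (mollifier n k).hasCompactSupport_normed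
  have hχd : Differentiable ℝ χ := hχs.differentiable (by simp)
  have hd : HasFDerivAt (mollify k f) _ x :=
    hχc.hasFDerivAt_convolution_left (lsmul ℝ ℝ) (hχs.of_le (by exact_mod_cast le_top))
      h.locallyIntegrable x
  have hex : ConvolutionExistsAt (fderiv ℝ χ) f x ((lsmul ℝ ℝ).precompL _) volume :=
    (hχc.fderiv (𝕜 := ℝ)).convolutionExists_left _ (hχs.continuous_fderiv (by simp))
      h.locallyIntegrable x
  rw [hd.fderiv, convolution_eq_swap]
  have hint := hex.integrable_swap
  rw [ContinuousLinearMap.integral_apply hint, mollify_eq_integral]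
  have key := h.integral_eq (fun y => χ (x - y)) (hχs.comp (contDiff_const.sub contDiff_id))
    (hχc.comp_homeomorph (Homeomorph.subLeft x))
  have hder : ∀ y, fderiv ℝ (fun y => χ (x - y)) y (EuclideanSpace.single i 1)
      = - fderiv ℝ χ (x - y) (EuclideanSpace.single i 1) := by
    intro y
    have := (hχd (x - y)).hasFDerivAt.comp y ((hasFDerivAt_id y).const_sub x)
    refine (congrArg (fun A => A (EuclideanSpace.single i 1)) this.fderiv).trans ?_
    simp
  simp only [hder, mul_neg, integral_neg, neg_inj] at key
  rw [show (∫ y, χ (x - y) * g y) = ∫ y, g y * χ (x - y) by simp only [mul_comm], ← key]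
  refine integral_congr_ae (ae_of_all _ fun y => ?_)
  simp [ContinuousLinearMap.precompL_apply, mul_comm]

theorem integrable_mollify (hf : Integrable f) (k : ℕ) : Integrable (mollify k f) :=
  (mollifier n k).integrable_normed.integrable_convolution _ hf

theorem integral_abs_mollify_le (hf : Integrable f) (k : ℕ) :
    ∫ x, |mollify k f x| ≤ ∫ x, |f x| := by
  have h1 : ∀ x, |mollify k f x| ≤ mollify k (fun y => |f y|) x := by
    intro x
    rw [mollify_eq_integral, mollify_eq_integral]
    refine (abs_integral_le_integral_abs).trans_eq (integral_congr_ae (ae_of_all _ fun y => ?_))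
    simp [abs_mul, abs_of_nonneg ((mollifier n k).nonneg_normed _)]
  calc ∫ x, |mollify k f x| ≤ ∫ x, mollify k (fun y => |f y|) x :=
        integral_mono (integrable_mollify hf k).abs (integrable_mollify hf.abs k) h1
    _ = ∫ x, |f x| := by
        rw [mollify, integral_convolution _ (mollifier n k).integrable_normed hf.abs,
          (mollifier n k).integral_normed]
        simp

theorem mollify_sub (hf : Integrable f) (hg : Integrable g) (k : ℕ)
    (x : EuclideanSpace ℝ (Fin n)) :
    mollify k (fun y => f y - g y) x = mollify k f x - mollify k g x := by
  rw [mollify, mollify, mollify, convolution, convolution, convolution, ← integral_sub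
    (convolutionExistsAt_mollify hf.locallyIntegrable k x)
    (convolutionExistsAt_mollify hg.locallyIntegrable k x)]
  simp [mul_sub]

/-- Mollifications converge in `L¹`. -/
theorem tendsto_integral_abs_mollify_sub (hf : Integrable f) :
    Tendsto (fun k => ∫ x, |mollify k f x - f x|) atTop (𝓝 0) := by
  rw [Metric.tendsto_atTop]
  intro ε hε
  obtain ⟨h, hc, hfh, hcont, hint⟩ :=
    hf.exists_hasCompactSupport_integral_sub_le (ε := ε / 4) (by positivity)
  simp only [Real.norm_eq_abs] at hfh
  obtain ⟨R, hR⟩ := exists_radius_of_hasCompactSupport hc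
  obtain ⟨C, hC⟩ := hc.exists_bound_of_continuous hcont
  have hcv : Tendsto (fun k => ∫ x, |mollify k h x - h x|) atTop (𝓝 0) := by
    rw [show (0 : ℝ) = ∫ _ : EuclideanSpace ℝ (Fin n), (0 : ℝ) by simp]
    refine tendsto_integral_of_dominated_convergence
      ((Metric.closedBall 0 (R + 1)).indicator fun _ => 2 * C) ?_ ?_ ?_ ?_
    · exact fun k => ((integrable_mollify hint k).sub hint).abs.aestronglyMeasurable
    · rw [integrable_indicator_iff measurableSet_closedBall]
      exact integrableOn_const (measure_closedBall_lt_top.ne)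
    · refine fun k => ae_of_all _ fun x => ?_
      by_cases hx : x ∈ Metric.closedBall 0 (R + 1)
      · rw [indicator_of_mem hx, Real.norm_eq_abs, abs_abs]
        have h1 := abs_mollify_le hC k x
        have h2 := hC x
        rw [Real.norm_eq_abs] at h2
        exact (abs_sub _ _).trans (by linarith)
      · rw [indicator_of_notMem hx]
        have hx' : R + 1 < ‖x‖ := by simpa using hx
        simp [mollify_eq_zero hR k hx', hR x (by linarith)]
    · refine ae_of_all _ fun x => ?_
      have := (tendsto_mollify hcont x).sub_const (h x)
      rw [sub_self] at this
      simpa using this.abs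
  obtain ⟨N, hN⟩ := (Metric.tendsto_atTop.1 hcv) (ε / 4) (by positivity)
  refine ⟨N, fun k hk => ?_⟩
  have h4 := hN k hk
  have hnn : ∀ u : EuclideanSpace ℝ (Fin n) → ℝ, 0 ≤ ∫ x, |u x| :=
    fun u => integral_nonneg fun x => abs_nonneg _
  rw [Real.dist_eq, sub_zero, abs_of_nonneg (hnn _)] at h4 ⊢
  have hle : ∀ x, |mollify k f x - f x| ≤
      |mollify k (fun y => f y - h y) x| + (|mollify k h x - h x| + |f x - h x|) := by
    intro x
    rw [mollify_sub hf hint]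
    calc |mollify k f x - f x| = |(mollify k f x - mollify k h x) +
          ((mollify k h x - h x) + -(f x - h x))| := by congr 1; ring
      _ ≤ _ := (abs_add_le _ _).trans (by
          gcongr; exact (abs_add_le _ _).trans (by rw [abs_neg]))
  have hi1 : Integrable fun x => |mollify k (fun y => f y - h y) x| :=
    (integrable_mollify (hf.sub hint) k).abs
  have hi2 : Integrable fun x => |mollify k h x - h x| := ((integrable_mollify hint k).sub hint).abs
  have hi3 : Integrable fun x => |f x - h x| := (hf.sub hint).abs
  calc ∫ x, |mollify k f x - f x|
      ≤ ∫ x, (|mollify k (fun y => f y - h y) x| + (|mollify k h x - h x| + |f x - h x|)) :=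
        integral_mono ((integrable_mollify hf k).sub hf).abs (hi1.add (hi2.add hi3)) hle
    _ = (∫ x, |mollify k (fun y => f y - h y) x|) +
          ((∫ x, |mollify k h x - h x|) + ∫ x, |f x - h x|) := by
        rw [← integral_add hi2 hi3]
        exact integral_add hi1 (hi2.add hi3)
    _ < ε := by
        have := integral_abs_mollify_le (hf.sub hint) k
        simp only [Pi.sub_apply] at this
        have h5 : ∫ x, |mollify k (fun y => f y - h y) x| ≤ ∫ x, |f x - h x| := this
        linarith

end Mollification

/-! ### Weak derivatives on zero sets -/

section Stampacchia

open ContinuousLinearMap Set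
open scoped Convolution

variable {n : ℕ} {f g : EuclideanSpace ℝ (Fin n) → ℝ}

/-- Weak chain rule for the bounded function `s ↦ ε arctan (s / ε)`, whose derivative
`1 / (1 + (s / ε)²)` tends to the indicator function of `{0}` as `ε → 0`. -/
theorem HasWeakPartialDeriv.integral_arctan_mul {i : Fin n} (h : HasWeakPartialDeriv i f g)
    (hg : Integrable g) {ε : ℝ} (hε : 0 < ε) {η : EuclideanSpace ℝ (Fin n) → ℝ}
    (hη : ContDiff ℝ ((⊤ : ℕ∞) : WithTop ℕ∞) η) (hc : HasCompactSupport η) :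
    ∫ x, ε * Real.arctan (f x / ε) * fderiv ℝ η x (EuclideanSpace.single i 1) =
      - ∫ x, (1 + (f x / ε) ^ 2)⁻¹ * g x * η x := by
  have hεne := hε.ne'
  set D : EuclideanSpace ℝ (Fin n) → ℝ := fun x => fderiv ℝ η x (EuclideanSpace.single i 1) with hD
  have hDcont : Continuous D := (hη.continuous_fderiv (by simp)).clm_apply continuous_const
  have hDc : HasCompactSupport D := by
    refine (hc.fderiv (𝕜 := ℝ)).mono fun x hx h0 => hx ?_
    simp [hD, h0]
  have hDint : Integrable D := hDcont.integrable_of_hasCompactSupport hDc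
  obtain ⟨C, hC⟩ := hc.exists_bound_of_continuous hη.continuous
  have hle1 : ∀ s : ℝ, |(1 + s ^ 2)⁻¹| ≤ 1 := fun s => by
    rw [abs_of_pos (by positivity)]
    exact inv_le_one_of_one_le₀ (by nlinarith [sq_nonneg s])
  have hgm : ∀ k, Continuous (mollify k g) := fun k =>
    (contDiff_mollify h.locallyIntegrable_deriv k).continuous
  have hfm : ∀ k, ContDiff ℝ ((⊤ : ℕ∞) : WithTop ℕ∞) (mollify k f) := fun k =>
    contDiff_mollify h.locallyIntegrable k
  have hac : ∀ k, Continuous fun x => (1 + (mollify k f x / ε) ^ 2)⁻¹ := fun k => by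
    have := (hfm k).continuous
    exact Continuous.inv₀ (by fun_prop) fun x => by positivity
  -- the identity for the smooth functions `mollify k f`
  have hk : ∀ k, ∫ x, ε * Real.arctan (mollify k f x / ε) * D x =
      - ∫ x, (1 + (mollify k f x / ε) ^ 2)⁻¹ * mollify k g x * η x := by
    intro k
    have hder : ∀ x, HasFDerivAt (fun x => ε * Real.arctan (mollify k f x / ε))
        ((1 + (mollify k f x / ε) ^ 2)⁻¹ • fderiv ℝ (mollify k f) x) x := by
      intro x
      have h1 := ((hfm k).differentiable (by simp) x).hasFDerivAt
      have h2 : HasDerivAt (fun s : ℝ => ε * Real.arctan (s / ε))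
          ((1 + (mollify k f x / ε) ^ 2)⁻¹) (mollify k f x) := by
        refine ((((hasDerivAt_id _).div_const ε).arctan).const_mul ε).congr_deriv ?_
        field_simp
      exact h2.comp_hasFDerivAt x h1
    have hval : ∀ x, fderiv ℝ (fun x => ε * Real.arctan (mollify k f x / ε)) x
        (EuclideanSpace.single i 1) = (1 + (mollify k f x / ε) ^ 2)⁻¹ * mollify k g x := by
      intro x
      rw [(hder x).fderiv, _root_.smul_apply, smul_eq_mul, fderiv_mollify_apply h]
    have hcont : Continuous fun x => ε * Real.arctan (mollify k f x / ε) :=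
      continuous_iff_continuousAt.2 fun x => (hder x).continuousAt
    have := integral_mul_fderiv_eq_neg_fderiv_mul_of_integrable
      (μ := (volume : Measure (EuclideanSpace ℝ (Fin n))))
      (f := fun x => ε * Real.arctan (mollify k f x / ε)) (g := η)
      (v := EuclideanSpace.single i 1) ?_ ?_ ?_ (fun x _ => (hder x).differentiableAt)
      (fun x _ => hη.differentiable (by simp) x)
    · simpa only [hval] using this
    · simp only [hval]
      exact (((hac k).mul (hgm k)).mul hη.continuous).integrable_of_hasCompactSupport hc.mul_left
    · exact (hcont.mul hDcont).integrable_of_hasCompactSupport hDc.mul_left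
    · exact (hcont.mul hη.continuous).integrable_of_hasCompactSupport hc.mul_left
  have hfae := ae_tendsto_mollify h.locallyIntegrable
  have hlim1 : Tendsto (fun k => ∫ x, ε * Real.arctan (mollify k f x / ε) * D x) atTop
      (𝓝 (∫ x, ε * Real.arctan (f x / ε) * D x)) := by
    refine tendsto_integral_of_dominated_convergence (fun x => ε * (Real.pi / 2) * |D x|) ?_
      (hDint.abs.const_mul _) ?_ ?_
    · intro k
      have := (hfm k).continuous
      exact Continuous.aestronglyMeasurable (by fun_prop)
    · refine fun k => ae_of_all _ fun x => ?_
      rw [norm_mul, norm_mul, Real.norm_eq_abs, Real.norm_eq_abs, Real.norm_eq_abs, abs_of_pos hε]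
      gcongr
      exact abs_le.2 ⟨(Real.neg_pi_div_two_lt_arctan _).le, (Real.arctan_lt_pi_div_two _).le⟩
    · filter_upwards [hfae] with x hx
      exact ((Real.continuous_arctan.tendsto _).comp (hx.div_const ε)).const_mul ε |>.mul_const _
  have hlim2 : Tendsto (fun k => ∫ x, (1 + (mollify k f x / ε) ^ 2)⁻¹ * g x * η x) atTop
      (𝓝 (∫ x, (1 + (f x / ε) ^ 2)⁻¹ * g x * η x)) := by
    refine tendsto_integral_of_dominated_convergence (fun x => |g x| * C) ?_
      (hg.abs.mul_const _) ?_ ?_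
    · exact fun k => ((hac k).aestronglyMeasurable.mul hg.aestronglyMeasurable).mul
        hη.continuous.aestronglyMeasurable
    · refine fun k => ae_of_all _ fun x => ?_
      rw [norm_mul, norm_mul, Real.norm_eq_abs, Real.norm_eq_abs]
      have := mul_le_mul_of_nonneg_right (hle1 (mollify k f x / ε)) (abs_nonneg (g x))
      rw [one_mul] at this
      exact mul_le_mul this (hC x) (norm_nonneg _) (abs_nonneg _)
    · filter_upwards [hfae] with x hx
      refine Tendsto.mul_const _ (Tendsto.mul_const _ (Tendsto.inv₀ ?_ (by positivity)))
      exact ((hx.div_const ε).pow 2).const_add 1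
  have hlim3 : Tendsto (fun k => (∫ x, (1 + (mollify k f x / ε) ^ 2)⁻¹ * mollify k g x * η x) -
      ∫ x, (1 + (mollify k f x / ε) ^ 2)⁻¹ * g x * η x) atTop (𝓝 0) := by
    have hz := (tendsto_integral_abs_mollify_sub hg).mul_const C
    rw [zero_mul] at hz
    refine squeeze_zero_norm (fun k => ?_) hz
    have hi : ∀ u : EuclideanSpace ℝ (Fin n) → ℝ, Integrable u →
        Integrable fun x => (1 + (mollify k f x / ε) ^ 2)⁻¹ * u x * η x := fun u hu =>
      (hu.bdd_mul (c := 1) (hac k).aestronglyMeasurable (ae_of_all _ fun x => hle1 _)).mul_bdd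
        (c := C) hη.continuous.aestronglyMeasurable (ae_of_all _ hC)
    rw [← integral_sub (hi _ (integrable_mollify hg k)) (hi _ hg), ← integral_mul_const]
    refine norm_integral_le_of_norm_le
      (((integrable_mollify hg k).sub hg).abs.mul_const C) (ae_of_all _ fun x => ?_)
    rw [← sub_mul, ← mul_sub, norm_mul, norm_mul, Real.norm_eq_abs, Real.norm_eq_abs]
    have := mul_le_mul_of_nonneg_right (hle1 (mollify k f x / ε))
      (abs_nonneg (mollify k g x - g x))
    rw [one_mul] at this
    exact mul_le_mul this (hC x) (norm_nonneg _) (abs_nonneg _)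
  have hlim4 := (hlim3.add hlim2).neg
  simp only [sub_add_cancel, zero_add] at hlim4
  simp only [hk] at hlim1
  exact tendsto_nhds_unique hlim1 hlim4

/-- **Stampacchia's lemma**: a weak partial derivative of `f` vanishes almost everywhere on the
zero set of `f`. -/
theorem HasWeakPartialDeriv.ae_eq_zero_of_eq_zero {i : Fin n} (h : HasWeakPartialDeriv i f g)
    (hg : Integrable g) : ∀ᵐ x, f x = 0 → g x = 0 := by
  classical
  have hfm := h.locallyIntegrable.aestronglyMeasurable
  set a : EuclideanSpace ℝ (Fin n) → ℝ := fun x => if f x = 0 then 1 else 0 with ha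
  have hlim : ∀ x, Tendsto (fun k : ℕ => (1 + (f x / (1 / ((k : ℝ) + 1))) ^ 2)⁻¹) atTop
      (𝓝 (a x)) := by
    intro x
    by_cases hx : f x = 0
    · simp [ha, hx]
    · simp only [ha, hx, if_false]
      refine Tendsto.inv_tendsto_atTop (tendsto_atTop_add_const_left _ _ ?_)
      have h1 : Tendsto (fun k : ℕ => (k : ℝ) + 1) atTop atTop :=
        tendsto_atTop_add_const_right _ _ tendsto_natCast_atTop_atTop
      have h2 : Tendsto (fun k : ℕ => f x ^ 2 * ((k : ℝ) + 1) ^ 2) atTop atTop :=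
        (((tendsto_pow_atTop two_ne_zero).comp h1)).const_mul_atTop (by positivity)
      refine h2.congr fun k => ?_
      field_simp
  have hle1 : ∀ s : ℝ, |(1 + s ^ 2)⁻¹| ≤ 1 := fun s => by
    rw [abs_of_pos (by positivity)]
    exact inv_le_one_of_one_le₀ (by nlinarith [sq_nonneg s])
  have hsm : ∀ ε : ℝ, AEStronglyMeasurable (fun x => (1 + (f x / ε) ^ 2)⁻¹) volume := fun ε =>
    (((hfm.aemeasurable.div_const ε).pow_const 2).const_add 1).inv.aestronglyMeasurable
  have ham : AEStronglyMeasurable a volume :=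
    aestronglyMeasurable_of_tendsto_ae atTop (fun k : ℕ => hsm (1 / ((k : ℝ) + 1)))
      (ae_of_all _ hlim)
  have hale : ∀ x, ‖a x‖ ≤ 1 := fun x => by simp only [ha]; split_ifs <;> simp
  have hagi : Integrable fun x => a x * g x := hg.bdd_mul (c := 1) ham (ae_of_all _ hale)
  have key : ∀ᵐ x, a x * g x = 0 := by
    refine ae_eq_zero_of_integral_contDiff_smul_eq_zero hagi.locallyIntegrable fun η hη hc => ?_
    obtain ⟨C, hC⟩ := hc.exists_bound_of_continuous hη.continuous
    set D : EuclideanSpace ℝ (Fin n) → ℝ := fun x => fderiv ℝ η x (EuclideanSpace.single i 1)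
      with hD
    have hDint : Integrable D := by
      refine Continuous.integrable_of_hasCompactSupport
        ((hη.continuous_fderiv (by simp)).clm_apply continuous_const)
        ((hc.fderiv (𝕜 := ℝ)).mono fun x hx h0 => hx ?_)
      simp [hD, h0]
    have hpos : ∀ k : ℕ, (0 : ℝ) < 1 / ((k : ℝ) + 1) := fun k => by positivity
    have hl1 : Tendsto (fun k : ℕ => ∫ x, (1 + (f x / (1 / ((k : ℝ) + 1))) ^ 2)⁻¹ * g x * η x)
        atTop (𝓝 (∫ x, a x * g x * η x)) := by
      refine tendsto_integral_of_dominated_convergence (fun x => |g x| * C) ?_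
        (hg.abs.mul_const _) ?_ ?_
      · exact fun k => ((hsm _).mul hg.aestronglyMeasurable).mul
          hη.continuous.aestronglyMeasurable
      · refine fun k => ae_of_all _ fun x => ?_
        rw [norm_mul, norm_mul, Real.norm_eq_abs, Real.norm_eq_abs]
        have := mul_le_mul_of_nonneg_right (hle1 (f x / (1 / ((k : ℝ) + 1)))) (abs_nonneg (g x))
        rw [one_mul] at this
        exact mul_le_mul this (hC x) (norm_nonneg _) (abs_nonneg _)
      · exact ae_of_all _ fun x => ((hlim x).mul_const _).mul_const _
    have hl2 : Tendsto (fun k : ℕ => ∫ x, (1 + (f x / (1 / ((k : ℝ) + 1))) ^ 2)⁻¹ * g x * η x)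
        atTop (𝓝 0) := by
      have hz := (tendsto_one_div_add_atTop_nhds_zero_nat (𝕜 := ℝ)).mul_const
        (Real.pi / 2 * ∫ x, |D x|)
      rw [zero_mul] at hz
      refine squeeze_zero_norm (fun k => ?_) hz
      rw [← norm_neg, ← h.integral_arctan_mul hg (hpos k) hη hc, ← mul_assoc, ← integral_const_mul]
      refine norm_integral_le_of_norm_le (hDint.abs.const_mul _) (ae_of_all _ fun x => ?_)
      rw [norm_mul, norm_mul, Real.norm_eq_abs, Real.norm_eq_abs, Real.norm_eq_abs,
        abs_of_pos (hpos k)]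
      gcongr
      exact abs_le.2 ⟨(Real.neg_pi_div_two_lt_arctan _).le, (Real.arctan_lt_pi_div_two _).le⟩
    rw [← tendsto_nhds_unique hl1 hl2]
    refine integral_congr_ae (ae_of_all _ fun x => ?_)
    simp [mul_comm]
  filter_upwards [key] with x hx hfx
  simpa [ha, hfx] using hx

end Stampacchia

/-! ### Lipschitz functions of compact support -/

section LipschitzFunctions

open ContinuousLinearMap Set
open scoped Convolution

variable {n : ℕ} {f g : EuclideanSpace ℝ (Fin n) → ℝ}

theorem clm_apply_eq_sum (A : EuclideanSpace ℝ (Fin n) →L[ℝ] ℝ) (v : EuclideanSpace ℝ (Fin n)) :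
    A v = ∑ i, v i * A (EuclideanSpace.single i 1) := by
  conv_lhs => rw [← (EuclideanSpace.basisFun (Fin n) ℝ).sum_repr v]
  simp

/-- A Lipschitz function has its line derivatives as weak partial derivatives. -/
theorem hasWeakPartialDeriv_of_lipschitzWith {L : NNReal} (hf : LipschitzWith L f) (i : Fin n) :
    HasWeakPartialDeriv i f fun x => lineDeriv ℝ f x (EuclideanSpace.single i 1) where
  locallyIntegrable := hf.continuous.locallyIntegrable
  locallyIntegrable_deriv := hf.locallyIntegrable_lineDeriv _
  integral_eq η hη hc := by
    obtain ⟨D, hD⟩ := (hη.of_le (by exact_mod_cast le_top) :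
      ContDiff ℝ 1 η).lipschitzWith_of_hasCompactSupport hc one_ne_zero
    rw [hf.integral_lineDeriv_mul_eq hD hc, ← integral_neg]
    refine integral_congr_ae (ae_of_all _ fun x => ?_)
    have hx : DifferentiableAt ℝ η x := hη.differentiable (by simp) x
    simp [hx.lineDeriv_eq_fderiv, mul_comm]

/-- The derivatives of the mollifications of a Lipschitz function converge almost everywhere, by
Rademacher's theorem. -/
theorem ae_tendsto_fderiv_mollify {L : NNReal} (hf : LipschitzWith L f) :
    ∀ᵐ x, ∀ v, Tendsto (fun k => fderiv ℝ (mollify k f) x v) atTop (𝓝 (fderiv ℝ f x v)) := by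
  have h : ∀ i : Fin n, ∀ᵐ x, Tendsto
      (fun k => mollify k (fun y => lineDeriv ℝ f y (EuclideanSpace.single i 1)) x) atTop
      (𝓝 (lineDeriv ℝ f x (EuclideanSpace.single i 1))) := fun i =>
    ae_tendsto_mollify (hf.locallyIntegrable_lineDeriv _)
  filter_upwards [ae_all_iff.2 h, hf.ae_differentiableAt] with x hx hd v
  rw [clm_apply_eq_sum (fderiv ℝ f x) v]
  simp only [fun k => clm_apply_eq_sum (fderiv ℝ (mollify k f) x) v]
  refine tendsto_finsetSum _ fun i _ => Tendsto.const_mul _ ?_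
  simp only [fderiv_mollify_apply (hasWeakPartialDeriv_of_lipschitzWith hf i),
    ← hd.lineDeriv_eq_fderiv]
  exact hx i

/-- For Lipschitz `f` of compact support, the functions `F · ∇(mollify k f)` are uniformly bounded
and supported in one ball. -/
theorem exists_bound_fderiv_mollify {F : EuclideanSpace ℝ (Fin n) → EuclideanSpace ℝ (Fin n)}
    (hF : Continuous F) {L : NNReal} (hf : LipschitzWith L f) (hc : HasCompactSupport f) :
    ∃ C, ∀ k x, |fderiv ℝ (mollify k f) x (F x)| ≤ C := by
  obtain ⟨R, hR⟩ := exists_radius_of_hasCompactSupport hc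
  obtain ⟨B, hB⟩ := (isCompact_closedBall (0 : EuclideanSpace ℝ (Fin n))
    (R + 1)).exists_bound_of_continuousOn hF.continuousOn
  refine ⟨L * max B 0, fun k x => ?_⟩
  by_cases hx : ‖x‖ ≤ R + 1
  · calc |fderiv ℝ (mollify k f) x (F x)| ≤ ‖fderiv ℝ (mollify k f) x‖ * ‖F x‖ :=
          (fderiv ℝ (mollify k f) x).le_opNorm _
      _ ≤ L * max B 0 := by
          gcongr
          · exact norm_fderiv_le_of_lipschitz ℝ (lipschitzWith_mollify hf k)
          · exact (hB x (by simpa using hx)).trans (le_max_left _ _)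
  · have h0 : mollify k f =ᶠ[𝓝 x] fun _ => 0 := by
      filter_upwards [(isOpen_lt continuous_const continuous_norm).mem_nhds (not_le.1 hx)] with y hy
      exact mollify_eq_zero hR k hy
    rw [h0.fderiv_eq]
    simp only [fderiv_fun_const, Pi.zero_apply, _root_.zero_apply, abs_zero]
    positivity

theorem exists_bound_of_hasCompactSupport (hf : Continuous f) (hc : HasCompactSupport f) :
    ∃ C, ∀ x, |f x| ≤ C :=
  hc.exists_bound_of_continuous hf

/-! ### The weak divergence of `ρF` -/

section Divergence

variable {ρ : EuclideanSpace ℝ (Fin n) → ℝ}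
  {F : EuclideanSpace ℝ (Fin n) → EuclideanSpace ℝ (Fin n)}

theorem MemW11.hasWeakPartialDeriv (h : MemW11 f) (i : Fin n) :
    HasWeakPartialDeriv i f (weakPartialDeriv i f) := by
  obtain ⟨g, -, hg⟩ := h.2 i
  have hex : ∃ g, HasWeakPartialDeriv i f g := ⟨g, hg⟩
  rw [weakPartialDeriv, dif_pos hex]
  exact hex.choose_spec

theorem MemW11.integrable_weakPartialDeriv (h : MemW11 f) (i : Fin n) :
    Integrable (weakPartialDeriv i f) := by
  obtain ⟨g, hgi, hg⟩ := h.2 i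
  exact hgi.congr (hg.ae_eq (h.hasWeakPartialDeriv i))

theorem integrable_weakDiv (hρF : ∀ i, MemW11 fun x => (ρ x • F x) i) :
    Integrable (weakDiv fun x => ρ x • F x) :=
  integrable_finsetSum _ fun i _ => (hρF i).integrable_weakPartialDeriv i

/-- The weak divergence of `ρF` vanishes almost everywhere where `ρ` does. -/
theorem ae_weakDiv_eq_zero (hρF : ∀ i, MemW11 fun x => (ρ x • F x) i) :
    ∀ᵐ x, ρ x = 0 → weakDiv (fun x => ρ x • F x) x = 0 := by
  filter_upwards [ae_all_iff.2 fun i => ((hρF i).hasWeakPartialDeriv i).ae_eq_zero_of_eq_zero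
    ((hρF i).integrable_weakPartialDeriv i)] with x hx h0
  exact Finset.sum_eq_zero fun i _ => hx i (by simp [h0])

/-- Integration by parts against a Lipschitz function of compact support. -/
theorem integral_mul_fderiv_eq_neg_weakDiv (hρF : ∀ i, MemW11 fun x => (ρ x • F x) i)
    (hρ : Integrable ρ) (hF : Continuous F) {L : NNReal} (hf : LipschitzWith L f)
    (hc : HasCompactSupport f) :
    ∫ x, ρ x * fderiv ℝ f x (F x) = - ∫ x, weakDiv (fun x => ρ x • F x) x * f x := by
  have hdiv := integrable_weakDiv hρF
  obtain ⟨R, hR⟩ := exists_radius_of_hasCompactSupport hc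
  have hsm : ∀ k, ContDiff ℝ ((⊤ : ℕ∞) : WithTop ℕ∞) (mollify k f) := fun k =>
    contDiff_mollify hf.continuous.locallyIntegrable k
  have hcs : ∀ k, HasCompactSupport (mollify k f) := fun k =>
    hasCompactSupport_of_forall_norm fun x hx => mollify_eq_zero hR k hx
  obtain ⟨C, hC⟩ := exists_bound_of_hasCompactSupport hf.continuous hc
  obtain ⟨C', hC'⟩ := exists_bound_fderiv_mollify hF hf hc
  have hk : ∀ k, ∫ x, ρ x * fderiv ℝ (mollify k f) x (F x) =
      - ∫ x, weakDiv (fun x => ρ x • F x) x * mollify k f x := by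
    intro k
    have e1 : ∀ x, ρ x * fderiv ℝ (mollify k f) x (F x) = ∑ i, (ρ x • F x) i *
        fderiv ℝ (mollify k f) x (EuclideanSpace.single i 1) := fun x => by
      rw [clm_apply_eq_sum, Finset.mul_sum]
      refine Finset.sum_congr rfl fun i _ => ?_
      simp [mul_assoc]
    have e2 : ∀ x, weakDiv (fun x => ρ x • F x) x * mollify k f x = ∑ i,
        weakPartialDeriv i (fun y => (ρ y • F y) i) x * mollify k f x := fun x => by
      rw [weakDiv, Finset.sum_mul]
    simp only [e1, e2]
    rw [integral_finsetSum, integral_finsetSum, ← Finset.sum_neg_distrib]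
    · exact Finset.sum_congr rfl fun i _ =>
        ((hρF i).hasWeakPartialDeriv i).integral_eq _ (hsm k) (hcs k)
    · exact fun i _ => ((hρF i).integrable_weakPartialDeriv i).mul_bdd (c := C)
        (hsm k).continuous.aestronglyMeasurable (ae_of_all _ fun x => abs_mollify_le hC k x)
    · intro i _
      have hcont : Continuous fun x => fderiv ℝ (mollify k f) x (EuclideanSpace.single i 1) :=
        ((hsm k).continuous_fderiv (by simp)).clm_apply continuous_const
      have hcomp : HasCompactSupport fun x =>
          fderiv ℝ (mollify k f) x (EuclideanSpace.single i 1) := by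
        refine ((hcs k).fderiv (𝕜 := ℝ)).mono fun x hx h0 => hx ?_
        change fderiv ℝ (mollify k f) x (EuclideanSpace.single i 1) = 0
        simp [h0]
      obtain ⟨B, hB⟩ := hcomp.exists_bound_of_continuous hcont
      exact (hρF i).1.mul_bdd (c := B) hcont.aestronglyMeasurable (ae_of_all _ hB)
  have l1 : Tendsto (fun k => ∫ x, ρ x * fderiv ℝ (mollify k f) x (F x)) atTop
      (𝓝 (∫ x, ρ x * fderiv ℝ f x (F x))) := by
    refine tendsto_integral_of_dominated_convergence (fun x => |ρ x| * C') ?_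
      (hρ.abs.mul_const _) ?_ ?_
    · exact fun k => hρ.aestronglyMeasurable.mul
        (((hsm k).continuous_fderiv (by simp)).clm_apply hF).aestronglyMeasurable
    · refine fun k => ae_of_all _ fun x => ?_
      rw [norm_mul, Real.norm_eq_abs, Real.norm_eq_abs]
      exact mul_le_mul_of_nonneg_left (hC' k x) (abs_nonneg _)
    · filter_upwards [ae_tendsto_fderiv_mollify hf] with x hx
      exact (hx _).const_mul _
  have l2 : Tendsto (fun k => ∫ x, weakDiv (fun x => ρ x • F x) x * mollify k f x) atTop
      (𝓝 (∫ x, weakDiv (fun x => ρ x • F x) x * f x)) := by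
    refine tendsto_integral_of_dominated_convergence
      (fun x => |weakDiv (fun x => ρ x • F x) x| * C) ?_ (hdiv.abs.mul_const _) ?_ ?_
    · exact fun k => hdiv.aestronglyMeasurable.mul (hsm k).continuous.aestronglyMeasurable
    · refine fun k => ae_of_all _ fun x => ?_
      rw [norm_mul, Real.norm_eq_abs, Real.norm_eq_abs]
      exact mul_le_mul_of_nonneg_left (abs_mollify_le hC k x) (abs_nonneg _)
    · exact ae_of_all _ fun x => (tendsto_mollify hf.continuous x).const_mul _
  simp only [hk] at l1
  exact tendsto_nhds_unique l1 l2.neg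

end Divergence

/-! ### Bounded convergence in `L²` and Lipschitz functions in the domain of the closure -/

/-- Uniformly bounded functions converging almost everywhere converge in `L²` of a finite measure.
The bound is required everywhere, since the index set may be uncountable. -/
theorem tendsto_toLp_of_bounded {α ι : Type*} [MeasurableSpace α] {P : Measure α}
    [IsFiniteMeasure P] {l : Filter ι} [l.IsCountablyGenerated] [l.NeBot]
    {f : ι → α → ℝ} {f₀ : α → ℝ} (hf : ∀ i, MemLp (f i) 2 P) (hf₀ : MemLp f₀ 2 P) {C : ℝ}
    (hb : ∀ i x, |f i x| ≤ C) (hlim : ∀ᵐ x ∂P, Tendsto (fun i => f i x) l (𝓝 (f₀ x))) :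
    Tendsto (fun i => (hf i).toLp (f i)) l (𝓝 (hf₀.toLp f₀)) := by
  rw [Lp.tendsto_Lp_iff_tendsto_eLpNorm'']
  have h0b : ∀ᵐ x ∂P, |f₀ x| ≤ C := by
    filter_upwards [hlim] with x hx
    exact le_of_tendsto hx.abs (Eventually.of_forall fun i => hb i x)
  have h1 : Tendsto (fun i => ∫ x, ‖f i x - f₀ x‖ ^ (2 : ℝ) ∂P) l (𝓝 0) := by
    have := tendsto_integral_filter_of_dominated_convergence (μ := P) (l := l)
      (F := fun i x => ‖f i x - f₀ x‖ ^ (2 : ℝ)) (f := fun _ => 0)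
      (fun _ => (2 * C) ^ (2 : ℝ)) ?_ ?_ (integrable_const _) ?_
    · simpa using this
    · exact Eventually.of_forall fun i =>
        (((hf i).1.sub hf₀.1).norm.aemeasurable.pow_const 2).aestronglyMeasurable
    · refine Eventually.of_forall fun i => ?_
      filter_upwards [h0b] with x hx
      rw [Real.norm_eq_abs, abs_of_nonneg (by positivity)]
      refine Real.rpow_le_rpow (norm_nonneg _) ?_ (by norm_num)
      exact (abs_sub _ _).trans (by linarith [hb i x])
    · filter_upwards [hlim] with x hx
      have h2 : Tendsto (fun i => ‖f i x - f₀ x‖) l (𝓝 0) := by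
        have := (hx.sub_const (f₀ x)).norm
        simpa using this
      have := h2.rpow_const (p := 2) (Or.inr (by norm_num))
      simpa using this
  have h3 := ENNReal.tendsto_ofReal (h1.rpow_const (p := 1 / 2) (Or.inr (by norm_num)))
  rw [Real.zero_rpow (by norm_num), ENNReal.ofReal_zero] at h3
  refine h3.congr fun i => ?_
  rw [((hf i).sub hf₀).eLpNorm_eq_integral_rpow_norm (by simp) (by simp)]
  simp

/-- A Lipschitz function of compact support lies in the domain of the closure of `F · ∇`, which
acts on it as `F · ∇` does pointwise almost everywhere. -/
theorem mem_closure_advectionGraph {F : EuclideanSpace ℝ (Fin n) → EuclideanSpace ℝ (Fin n)}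
    (hF : Continuous F) {P : Measure (EuclideanSpace ℝ (Fin n))} [IsFiniteMeasure P]
    (hP : P ≪ volume) {L : NNReal} (hf : LipschitzWith L f) (hc : HasCompactSupport f)
    {p : Lp ℝ 2 P × Lp ℝ 2 P} (h1 : p.1 =ᵐ[P] f) (h2 : p.2 =ᵐ[P] fun x => fderiv ℝ f x (F x)) :
    p ∈ (advectionGraph F P).topologicalClosure := by
  obtain ⟨R, hR⟩ := exists_radius_of_hasCompactSupport hc
  have hsm : ∀ k, ContDiff ℝ 1 (mollify k f) := fun k =>
    (contDiff_mollify hf.continuous.locallyIntegrable k).of_le (by exact_mod_cast le_top)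
  have hcs : ∀ k, HasCompactSupport (mollify k f) := fun k =>
    hasCompactSupport_of_forall_norm fun x hx => mollify_eq_zero hR k hx
  obtain ⟨C, hC⟩ := exists_bound_of_hasCompactSupport hf.continuous hc
  obtain ⟨C', hC'⟩ := exists_bound_fderiv_mollify hF hf hc
  choose q hq hq1 hq2 using fun k => exists_mem_advectionGraph hF P (hsm k) (hcs k)
  have m1 : ∀ k, MemLp (mollify k f) 2 P := fun k => (memLp_congr_ae (hq1 k)).1 (Lp.memLp _)
  have m2 : ∀ k, MemLp (fun x => fderiv ℝ (mollify k f) x (F x)) 2 P := fun k =>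
    (memLp_congr_ae (hq2 k)).1 (Lp.memLp _)
  have m3 : MemLp f 2 P := (memLp_congr_ae h1).1 (Lp.memLp _)
  have m4 : MemLp (fun x => fderiv ℝ f x (F x)) 2 P := (memLp_congr_ae h2).1 (Lp.memLp _)
  have t1 := tendsto_toLp_of_bounded (l := atTop) m1 m3 (fun k x => abs_mollify_le hC k x)
    (ae_of_all _ fun x => tendsto_mollify hf.continuous x)
  have t2 := tendsto_toLp_of_bounded (l := atTop) m2 m4 hC'
    (by filter_upwards [hP.ae_le (ae_tendsto_fderiv_mollify hf)] with x hx using hx _)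
  have e1 : ∀ k, (m1 k).toLp _ = (q k).1 := fun k => Lp.ext ((m1 k).coeFn_toLp.trans (hq1 k).symm)
  have e2 : ∀ k, (m2 k).toLp _ = (q k).2 := fun k => Lp.ext ((m2 k).coeFn_toLp.trans (hq2 k).symm)
  have e3 : m3.toLp _ = p.1 := Lp.ext (m3.coeFn_toLp.trans h1.symm)
  have e4 : m4.toLp _ = p.2 := Lp.ext (m4.coeFn_toLp.trans h2.symm)
  simp only [e1, e3] at t1
  simp only [e2, e4] at t2
  exact mem_closure_of_tendsto (t1.prodMk_nhds t2) (Eventually.of_forall hq)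

end LipschitzFunctions

/-! ### The global flow of a Lipschitz vector field -/

section GlobalFlow

open Set

variable {E : Type*} [NormedAddCommGroup E] [NormedSpace ℝ E] {F : E → E} {K : NNReal}

/-- The time of existence in the Picard–Lindelöf theorem is uniform in the initial value for a
globally Lipschitz vector field: on the ball of radius `‖F x‖ + 1` about `x` the field is bounded
by `(K + 1) (‖F x‖ + 1)`. -/
theorem exists_hasDerivAt_Ioo_of_lipschitzWith [CompleteSpace E] (hF : LipschitzWith K F) (x : E) :
    ∃ γ : ℝ → E, γ 0 = x ∧
      ∀ t ∈ Ioo (-(1 / ((K : ℝ) + 1))) (1 / ((K : ℝ) + 1)), HasDerivAt γ (F (γ t)) t := by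
  set T : ℝ := 1 / ((K : ℝ) + 1) with hT
  have hT0 : 0 < T := by positivity
  have hpl : IsPicardLindelof (fun _ => F) (tmin := -T) (tmax := T)
      ⟨0, by simp [hT0.le], hT0.le⟩ x (‖F x‖₊ + 1) 0 ((K + 1) * (‖F x‖₊ + 1)) K := by
    refine IsPicardLindelof.of_time_independent (fun y hy => ?_) hF.lipschitzOnWith ?_
    · have h1 : ‖F y - F x‖ ≤ K * ‖y - x‖ := hF.norm_sub_le y x
      have h2 : ‖y - x‖ ≤ ‖F x‖ + 1 := by simpa [dist_eq_norm] using hy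
      have h3 : ‖F y‖ ≤ ‖F y - F x‖ + ‖F x‖ := norm_le_norm_sub_add _ _
      push_cast
      have h4 : (K : ℝ) * ‖y - x‖ ≤ K * (‖F x‖ + 1) := by gcongr
      linarith
    · push_cast
      rw [sub_zero, zero_sub, neg_neg, max_self, hT, sub_zero]
      field_simp
      rfl
  obtain ⟨γ, h0, hγ⟩ := hpl.exists_eq_forall_mem_Icc_hasDerivWithinAt₀
  exact ⟨γ, h0, fun t ht => (hγ t (Ioo_subset_Icc_self ht)).hasDerivAt (Icc_mem_nhds ht.1 ht.2)⟩

/-- Global integral curves exist by the uniform time lemma. -/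
theorem exists_hasDerivAt_of_lipschitzWith [CompleteSpace E] (hF : LipschitzWith K F)
    (hF1 : ContDiff ℝ 1 F) (x : E) :
    ∃ γ : ℝ → E, γ 0 = x ∧ ∀ t, HasDerivAt γ (F (γ t)) t := by
  have := exists_isMIntegralCurve_of_isMIntegralCurveOn (I := modelWithCornersSelf ℝ E) (M := E)
    (v := F) ?_ (ε := 1 / ((K : ℝ) + 1)) (by positivity) ?_ x
  · obtain ⟨γ, h0, hγ⟩ := this
    refine ⟨γ, h0, fun t => ?_⟩
    have h : HasFDerivAt γ ((1 : ℝ →L[ℝ] ℝ).smulRight (F (γ t))) t :=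
      hasMFDerivAt_iff_hasFDerivAt.1 (hγ t)
    simpa using h.hasDerivAt
  · exact contMDiff_vectorSpace_iff_contDiff.2 hF1
  · intro x
    obtain ⟨γ, h0, hγ⟩ := exists_hasDerivAt_Ioo_of_lipschitzWith hF x
    refine ⟨γ, h0, fun t ht => HasMFDerivAt.hasMFDerivWithinAt ?_⟩
    exact hasMFDerivAt_iff_hasFDerivAt.2 (hγ t ht).hasFDerivAt

/-- Grönwall's inequality in both time directions. -/
theorem dist_le_exp_of_hasDerivAt (hF : LipschitzWith K F) {γ δ : ℝ → E}
    (hγ : ∀ t, HasDerivAt γ (F (γ t)) t) (hδ : ∀ t, HasDerivAt δ (F (δ t)) t) (t : ℝ) :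
    dist (γ t) (δ t) ≤ dist (γ 0) (δ 0) * Real.exp (K * |t|) := by
  have aux : ∀ {G : E → E} {γ δ : ℝ → E}, LipschitzWith K G → (∀ t, HasDerivAt γ (G (γ t)) t) →
      (∀ t, HasDerivAt δ (G (δ t)) t) → ∀ t, 0 ≤ t →
      dist (γ t) (δ t) ≤ dist (γ 0) (δ 0) * Real.exp (K * t) := by
    intro G γ δ hG hγ hδ t ht
    have := dist_le_of_trajectories_ODE (v := fun _ => G) (fun _ => hG)
      (HasDerivAt.continuousOn fun s _ => hγ s) (fun s _ => (hγ s).hasDerivWithinAt)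
      (HasDerivAt.continuousOn fun s _ => hδ s) (fun s _ => (hδ s).hasDerivWithinAt)
      (le_refl (dist (γ 0) (δ 0))) t ⟨ht, le_rfl⟩
    simpa using this
  rcases le_total 0 t with ht | ht
  · rw [abs_of_nonneg ht]
    exact aux hF hγ hδ t ht
  · -- the time-reversed curves are integral curves of `-F`
    have hr : ∀ {γ : ℝ → E}, (∀ t, HasDerivAt γ (F (γ t)) t) →
        ∀ t, HasDerivAt (fun s => γ (-s)) (-F (γ (-t))) t := fun {γ} h t => by
      simpa [Function.comp_def] using (h (-t)).scomp t (hasDerivAt_neg t)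
    have hG : LipschitzWith K fun x => -F x := fun x y => by
      simpa [edist_neg_neg] using hF x y
    have := aux hG (hr hγ) (hr hδ) (-t) (by linarith)
    rw [abs_of_nonpos ht]
    simpa using this

/-- A globally Lipschitz `C¹` vector field has a global flow. -/
theorem exists_flow_of_lipschitzWith [CompleteSpace E] (hF : LipschitzWith K F)
    (hF1 : ContDiff ℝ 1 F) :
    ∃ φ : Flow ℝ E, ∀ x t, HasDerivAt (fun s => φ s x) (F (φ t x)) t := by
  choose γ h0 hγ using exists_hasDerivAt_of_lipschitzWith hF hF1
  refine ⟨⟨fun t x => γ x t, ?_, fun t s x => ?_, h0⟩, hγ⟩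
  · rw [continuous_iff_continuousAt]
    rintro ⟨t, x⟩
    rw [ContinuousAt, tendsto_iff_dist_tendsto_zero]
    have h1 : Tendsto (fun p : ℝ × E => dist p.2 x * Real.exp (K * |p.1|) + dist (γ x p.1) (γ x t))
        (𝓝 (t, x)) (𝓝 0) := by
      have hc : Continuous (γ x) := continuous_iff_continuousAt.2 fun s => (hγ x s).continuousAt
      have : Continuous fun p : ℝ × E =>
          dist p.2 x * Real.exp (K * |p.1|) + dist (γ x p.1) (γ x t) := by fun_prop
      simpa using this.tendsto (t, x)
    refine squeeze_zero (fun _ => dist_nonneg) (fun p => ?_) h1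
    refine (dist_triangle _ (γ x p.1) _).trans ?_
    have := dist_le_exp_of_hasDerivAt hF (hγ p.2) (hγ x) p.1
    rw [h0, h0] at this
    exact add_le_add this le_rfl
  · have h1 : ∀ r, HasDerivAt (fun r => γ x (r + s)) (F (γ x (r + s))) r := fun r =>
      (hγ x (r + s)).comp_add_const r s
    have := dist_le_exp_of_hasDerivAt hF h1 (hγ (γ x s)) t
    rw [h0, zero_add, dist_self, zero_mul] at this
    exact dist_le_zero.1 this

theorem lipschitzWith_flow (hF : LipschitzWith K F) {φ : Flow ℝ E}
    (hφ : ∀ x t, HasDerivAt (fun s => φ s x) (F (φ t x)) t) (t : ℝ) :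
    LipschitzWith (Real.exp (K * |t|)).toNNReal (φ t) := by
  refine LipschitzWith.of_dist_le_mul fun x y => ?_
  have := dist_le_exp_of_hasDerivAt hF (hφ x) (hφ y) t
  rw [φ.map_zero_apply, φ.map_zero_apply] at this
  rw [Real.coe_toNNReal _ (Real.exp_pos _).le, mul_comm]
  exact this

end GlobalFlow

/-! ### Strongly continuous groups and cores of their generators -/

section Generators

open Set

variable {H : Type*} [NormedAddCommGroup H] [NormedSpace ℝ H] {U : ℝ → H →L[ℝ] H}

theorem mem_graph_generator {x y : H} :
    (x, y) ∈ (generator U).graph ↔ HasDerivAt (fun t => U t x) y 0 := by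
  rw [LinearPMap.mem_graph_iff]
  constructor
  · rintro ⟨z, rfl, rfl⟩
    exact DifferentiableAt.hasDerivAt z.2
  · exact fun h => ⟨⟨x, h.differentiableAt⟩, rfl, h.deriv⟩

theorem IsC0Group.hasDerivAt_orbit (hU : IsC0Group U) {x y : H}
    (h : HasDerivAt (fun t => U t x) y 0) (t : ℝ) : HasDerivAt (fun s => U s x) (U t y) t := by
  have h1 : HasDerivAt (fun s => U t (U (s - t) x)) (U t y) t := by
    have : HasDerivAt (fun s => U (s - t) x) y t := by
      have h2 : HasDerivAt (fun r => U r x) y (t - t) := by rwa [sub_self]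
      exact h2.comp_sub_const t t
    exact (U t).hasFDerivAt.comp_hasDerivAt t this
  refine h1.congr_of_eventuallyEq (Eventually.of_forall fun s => ?_)
  have := congrArg (fun A => A x) (hU.map_add t (s - t))
  simpa using this

theorem IsC0Group.continuous_uncurry (hU : IsC0Group U) {c : ℝ → ℝ} (hc : Continuous c)
    (hb : ∀ t, ‖U t‖ ≤ c t) : Continuous fun p : H × ℝ => U p.2 p.1 := by
  rw [continuous_iff_continuousAt]
  rintro ⟨x, t⟩
  rw [ContinuousAt, tendsto_iff_dist_tendsto_zero]
  have h1 : Tendsto (fun p : H × ℝ => c p.2 * ‖p.1 - x‖ + dist (U p.2 x) (U t x)) (𝓝 (x, t))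
      (𝓝 0) := by
    have h2 := hU.continuous_orbit x
    have : Continuous fun p : H × ℝ => c p.2 * ‖p.1 - x‖ + dist (U p.2 x) (U t x) := by fun_prop
    simpa using this.tendsto (x, t)
  refine squeeze_zero (fun _ => dist_nonneg) (fun p => ?_) h1
  refine (dist_triangle _ (U p.2 x) _).trans (add_le_add ?_ le_rfl)
  rw [dist_eq_norm, ← _root_.map_sub]
  exact (U p.2).le_of_opNorm_le (hb _) _

/-- For a locally bounded family of operators, continuity of the orbits may be checked on a dense
set. -/
theorem continuous_orbit_of_dense {c : ℝ → ℝ} (hc : Continuous c) (hb : ∀ t, ‖U t‖ ≤ c t)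
    {S : Set H} (hS : Dense S) (h : ∀ x ∈ S, Continuous fun t => U t x) (x : H) :
    Continuous fun t => U t x := by
  refine continuous_iff_continuousAt.2 fun t => ?_
  refine continuousAt_of_locally_uniform_approx_of_continuousAt fun u hu => ?_
  obtain ⟨ε, hε, hεu⟩ := Metric.mem_uniformity_dist.1 hu
  have hM : 0 < c t + 1 := by linarith [(norm_nonneg _).trans (hb t)]
  obtain ⟨y, hxy, hy⟩ := Metric.dense_iff.1 hS x (ε / (c t + 1)) (by positivity)
  refine ⟨{s | c s < c t + 1}, (isOpen_lt hc continuous_const).mem_nhds (by simp),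
    fun s => U s y, (h y hy).continuousAt, fun s hs => hεu ?_⟩
  rw [Metric.mem_ball, dist_comm, dist_eq_norm] at hxy
  rw [dist_eq_norm, ← _root_.map_sub]
  calc ‖U s (x - y)‖ ≤ (c t + 1) * ‖x - y‖ :=
        (U s).le_of_opNorm_le ((hb s).trans (le_of_lt hs)) _
    _ < (c t + 1) * (ε / (c t + 1)) := by gcongr
    _ = ε := by field_simp

variable [CompleteSpace H]

/-- The integrated form of membership in the graph of the generator, which passes to limits. -/
theorem IsC0Group.hasDerivAt_iff_forall_integral (hU : IsC0Group U) {x y : H} :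
    HasDerivAt (fun t => U t x) y 0 ↔ ∀ h : ℝ, U h x - x = ∫ s in (0 : ℝ)..h, U s y := by
  have hc := hU.continuous_orbit y
  constructor
  · intro hd h
    rw [intervalIntegral.integral_eq_sub_of_hasDerivAt (fun s _ => hU.hasDerivAt_orbit hd s)
      (hc.intervalIntegrable _ _), hU.map_zero]
    rfl
  · intro hi
    have h1 := (intervalIntegral.integral_hasDerivAt_right (hc.intervalIntegrable 0 0)
      (hc.stronglyMeasurableAtFilter _ _) hc.continuousAt).add_const x
    rw [hU.map_zero] at h1
    refine h1.congr_of_eventuallyEq (Eventually.of_forall fun s => ?_)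
    exact eq_add_of_sub_eq (hi s)

/-- The generator of a strongly continuous group is a closed operator. -/
theorem IsC0Group.isClosed_generator (hU : IsC0Group U) {c : ℝ → ℝ} (hc : Continuous c)
    (hb : ∀ t, ‖U t‖ ≤ c t) : (generator U).IsClosed := by
  have hcu := hU.continuous_uncurry hc hb
  have : ((generator U).graph : Set (H × H)) =
      ⋂ h : ℝ, {p : H × H | U h p.1 - p.1 = ∫ s in (0 : ℝ)..h, U s p.2} := by
    ext ⟨x, y⟩
    rw [SetLike.mem_coe, mem_graph_generator, hU.hasDerivAt_iff_forall_integral]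
    simp
  rw [LinearPMap.IsClosed, this]
  refine isClosed_iInter fun h => isClosed_eq (by fun_prop) ?_
  exact intervalIntegral.continuous_parametric_intervalIntegral_of_continuous'
    (f := fun (p : H × H) s => U s p.2)
    (hcu.comp (Continuous.prodMk (continuous_snd.comp continuous_fst) continuous_snd)) 0 h

/-- A closed subspace `G` of `H × H` containing the orbits of a subset `S` of the graph of the
generator contains the whole graph, provided that the domain of `S` is dense: `(x, y)` is the limit
of the means over `[0, h]` of the orbit of `(x, y)`, and these depend continuously on `x` alone. -/
theorem IsC0Group.mem_of_hasDerivAt (hU : IsC0Group U) {c : ℝ → ℝ} (hc : Continuous c)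
    (hb : ∀ t, ‖U t‖ ≤ c t) {G : Submodule ℝ (H × H)} (hG : IsClosed (G : Set (H × H)))
    {S : Set (H × H)} (hS : ∀ p ∈ S, HasDerivAt (fun t => U t p.1) p.2 0)
    (hSG : ∀ p ∈ S, ∀ s, (U s p.1, U s p.2) ∈ G) (hSd : Dense (Prod.fst '' S)) {x y : H}
    (hxy : HasDerivAt (fun t => U t x) y 0) : (x, y) ∈ G := by
  have hcu := hU.continuous_uncurry hc hb
  have key : ∀ h : ℝ, 0 < h → ∀ z : H, (h⁻¹ • ∫ s in (0 : ℝ)..h, U s z, h⁻¹ • (U h z - z)) ∈ G := by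
    intro h hh z
    have hclosed : IsClosed {z : H | (h⁻¹ • ∫ s in (0 : ℝ)..h, U s z, h⁻¹ • (U h z - z)) ∈ G} := by
      refine hG.preimage (Continuous.prodMk (Continuous.const_smul ?_ _) (by fun_prop))
      exact intervalIntegral.continuous_parametric_intervalIntegral_of_continuous'
        (f := fun (z : H) s => U s z) hcu 0 h
    refine hclosed.closure_subset_iff.2 ?_ (hSd z)
    rintro _ ⟨p, hp, rfl⟩
    have hpc : Continuous fun s => (U s p.1, U s p.2) :=
      (hU.continuous_orbit _).prodMk (hU.continuous_orbit _)
    have hmem := G.convex.set_average_mem (μ := volume) (t := Ioc 0 h)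
      (f := fun s => (U s p.1, U s p.2)) hG (by simp [hh]) (by simp)
      (ae_of_all _ fun s => hSG p hp s) (hpc.integrableOn_Ioc)
    rw [setAverage_eq, ← intervalIntegral.integral_of_le hh.le, Real.volume_real_Ioc_of_le hh.le,
      sub_zero] at hmem
    have e1 : (∫ s in (0 : ℝ)..h, (U s p.1, U s p.2)) =
        (∫ s in (0 : ℝ)..h, U s p.1, ∫ s in (0 : ℝ)..h, U s p.2) := by
      have i := hpc.intervalIntegrable (μ := volume) 0 h
      refine Prod.ext ?_ ?_
      · exact ((ContinuousLinearMap.fst ℝ H H).intervalIntegral_comp_comm i).symm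
      · exact ((ContinuousLinearMap.snd ℝ H H).intervalIntegral_comp_comm i).symm
    rw [e1, ← hU.hasDerivAt_iff_forall_integral.1 (hS p hp) h] at hmem
    exact hmem
  have hcx := hU.continuous_orbit x
  have l1 : Tendsto (fun h : ℝ => h⁻¹ • ∫ s in (0 : ℝ)..h, U s x) (𝓝[>] 0) (𝓝 x) := by
    have := (intervalIntegral.integral_hasDerivAt_right (hcx.intervalIntegrable 0 0)
      (hcx.stronglyMeasurableAtFilter _ _) hcx.continuousAt).tendsto_slope_zero_right
    simpa [hU.map_zero] using this
  have l2 : Tendsto (fun h : ℝ => h⁻¹ • (U h x - x)) (𝓝[>] 0) (𝓝 y) := by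
    simpa [hU.map_zero] using hxy.tendsto_slope_zero_right
  exact hG.mem_of_tendsto (l1.prodMk_nhds l2)
    (eventually_nhdsWithin_of_forall fun h hh => key h hh x)

end Generators

section TransportOfMeasure

open Set

/-! ### Comparison of measures and composition operators -/

/-- Two finite measures on `ℝⁿ` can be compared by means of nonnegative functions in `C¹_c`. -/
theorem measure_le_smul_of_forall_integral_le {n : ℕ} {ν P : Measure (EuclideanSpace ℝ (Fin n))}
    [IsFiniteMeasure ν] [IsFiniteMeasure P] {c : NNReal}
    (h : ∀ u : EuclideanSpace ℝ (Fin n) → ℝ, ContDiff ℝ 1 u → HasCompactSupport u → (∀ x, 0 ≤ u x) →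
      ∫ x, u x ∂ν ≤ c * ∫ x, u x ∂P) : ν ≤ c • P := by
  -- a smooth bump function between a compact set and an open set compares the two measures
  have hKV : ∀ K V : Set (EuclideanSpace ℝ (Fin n)), IsCompact K → IsOpen V → K ⊆ V →
      ν K ≤ (c • P) V := by
    intro K V hK hV hKV
    obtain ⟨r, hr⟩ := hK.isBounded.subset_ball 0
    obtain ⟨u, hu, hu01, hus, huK⟩ := exists_contMDiff_support_eq_eq_one_iff
      (modelWithCornersSelf ℝ (EuclideanSpace ℝ (Fin n))) (n := 1)
      (hV.inter (Metric.isOpen_ball (x := 0) (ε := r))) hK.isClosed (subset_inter hKV hr)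
    have hu1 : ContDiff ℝ 1 u := hu.contDiff
    have huc : HasCompactSupport u := by
      refine HasCompactSupport.intro (isCompact_closedBall 0 r) fun x hx => ?_
      by_contra h0
      have : x ∈ V ∩ Metric.ball 0 r := hus ▸ (show x ∈ Function.support u from h0)
      exact hx (Metric.ball_subset_closedBall this.2)
    have hu0 : ∀ x, 0 ≤ u x := fun x => (hu01 ⟨x, rfl⟩).1
    have hu1' : ∀ x, u x ≤ 1 := fun x => (hu01 ⟨x, rfl⟩).2
    have h1 : ν.real K ≤ ∫ x, u x ∂ν := by
      rw [← integral_indicator_one hK.measurableSet]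
      refine integral_mono ((integrable_const (1 : ℝ)).indicator hK.measurableSet)
        (hu1.continuous.integrable_of_hasCompactSupport huc) fun x => ?_
      by_cases hx : x ∈ K
      · simp [hx, (huK x).1 hx]
      · simpa [hx] using hu0 x
    have h2 : ∫ x, u x ∂P ≤ P.real V := by
      rw [← integral_indicator_one hV.measurableSet]
      refine integral_mono (hu1.continuous.integrable_of_hasCompactSupport huc)
        ((integrable_const (1 : ℝ)).indicator hV.measurableSet) fun x => ?_
      by_cases hx : x ∈ V
      · simpa [hx] using hu1' x
      · have : x ∉ Function.support u := fun h0 => hx (hus ▸ h0 : x ∈ V ∩ Metric.ball 0 r).1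
        simp [hx, Function.notMem_support.1 this]
    have h3 : ν.real K ≤ (c • P).real V := by
      refine h1.trans ((h u hu1 huc hu0).trans ?_)
      rw [measureReal_nnreal_smul_apply]
      gcongr
    exact (ENNReal.toReal_le_toReal (measure_ne_top _ _) (measure_ne_top _ _)).1 h3
  refine Measure.le_iff.2 fun s hs => ?_
  rw [hs.measure_eq_iSup_isCompact ν, s.measure_eq_iInf_isOpen (c • P)]
  exact iSup_le fun K => iSup_le fun hK => iSup_le fun hKc => le_iInf fun V => le_iInf fun hV =>
    le_iInf fun hVo => hKV K V hKc hVo (hK.trans hV)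

section Composition

variable {α : Type*} [MeasurableSpace α] {P : Measure α} {ψ : α → α} {c : NNReal}

theorem memLp_comp_of_map_le (hψ : Measurable ψ) (h : P.map ψ ≤ c • P) {x : α → ℝ}
    (hx : MemLp x 2 P) : MemLp (x ∘ ψ) 2 P :=
  (hx.of_measure_le_smul (c := c) ENNReal.coe_ne_top h).comp_of_map hψ.aemeasurable

theorem quasiMeasurePreserving_of_map_le (hψ : Measurable ψ) (h : P.map ψ ≤ c • P) :
    Measure.QuasiMeasurePreserving ψ P P :=
  ⟨hψ, (Measure.absolutelyContinuous_of_le h).trans (Measure.smul_absolutelyContinuous)⟩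

theorem eLpNorm_comp_le (hψ : Measurable ψ) (h : P.map ψ ≤ c • P) {x : α → ℝ}
    (hx : MemLp x 2 P) : eLpNorm (x ∘ ψ) 2 P ≤ (c : ℝ≥0∞) ^ (1 / 2 : ℝ) * eLpNorm x 2 P := by
  rw [← eLpNorm_map_measure (hx.of_measure_le_smul (c := c) ENNReal.coe_ne_top h).1
    hψ.aemeasurable]
  refine (eLpNorm_mono_measure x h).trans_eq ?_
  have := eLpNorm_smul_measure_of_ne_top (p := 2) (μ := P) (by simp) x (c : ℝ≥0∞)
  simpa using this

/-- The composition operator `x ↦ x ∘ ψ` on `L²(P)`, for a map `ψ` whose image measure `ψ_* P` is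
bounded by a multiple of `P`. -/
noncomputable def compOperator (hψ : Measurable ψ) (h : P.map ψ ≤ c • P) :
    Lp ℝ 2 P →L[ℝ] Lp ℝ 2 P :=
  LinearMap.mkContinuous
    { toFun := fun X => (memLp_comp_of_map_le hψ h (Lp.memLp X)).toLp _
      map_add' := fun X Y => by
        refine Lp.ext ?_
        have h1 := (quasiMeasurePreserving_of_map_le hψ h).ae_eq_comp (Lp.coeFn_add X Y)
        filter_upwards [MemLp.coeFn_toLp (memLp_comp_of_map_le hψ h (Lp.memLp (X + Y))), h1,
          MemLp.coeFn_toLp (memLp_comp_of_map_le hψ h (Lp.memLp X)),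
          MemLp.coeFn_toLp (memLp_comp_of_map_le hψ h (Lp.memLp Y)),
          Lp.coeFn_add ((memLp_comp_of_map_le hψ h (Lp.memLp X)).toLp _)
            ((memLp_comp_of_map_le hψ h (Lp.memLp Y)).toLp _)] with a e1 e2 e3 e4 e5
        rw [e1, e5, e2, Pi.add_apply, e3, e4]
        rfl
      map_smul' := fun r X => by
        refine Lp.ext ?_
        have h1 := (quasiMeasurePreserving_of_map_le hψ h).ae_eq_comp (Lp.coeFn_smul r X)
        filter_upwards [MemLp.coeFn_toLp (memLp_comp_of_map_le hψ h (Lp.memLp (r • X))), h1,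
          MemLp.coeFn_toLp (memLp_comp_of_map_le hψ h (Lp.memLp X)),
          Lp.coeFn_smul r ((memLp_comp_of_map_le hψ h (Lp.memLp X)).toLp _)] with a e1 e2 e3 e5
        rw [e1, RingHom.id_apply, e5, e2, Pi.smul_apply, e3]
        rfl }
    (Real.sqrt c) fun X => by
      change ‖(memLp_comp_of_map_le hψ h (Lp.memLp X)).toLp _‖ ≤ _
      rw [Lp.norm_toLp, Lp.norm_def]
      have := ENNReal.toReal_mono (ENNReal.mul_ne_top
        (ENNReal.rpow_ne_top_of_nonneg (by norm_num) ENNReal.coe_ne_top) (Lp.eLpNorm_ne_top X))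
        (eLpNorm_comp_le hψ h (Lp.memLp X))
      rwa [ENNReal.toReal_mul, ← ENNReal.toReal_rpow, ENNReal.coe_toReal,
        ← Real.sqrt_eq_rpow] at this

theorem coeFn_compOperator (hψ : Measurable ψ) (h : P.map ψ ≤ c • P) (X : Lp ℝ 2 P) :
    compOperator hψ h X =ᵐ[P] X ∘ ψ :=
  (memLp_comp_of_map_le hψ h (Lp.memLp X)).coeFn_toLp

theorem compOperator_ae_eq (hψ : Measurable ψ) (h : P.map ψ ≤ c • P) {X : Lp ℝ 2 P} {x : α → ℝ}
    (hx : X =ᵐ[P] x) : compOperator hψ h X =ᵐ[P] x ∘ ψ :=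
  (coeFn_compOperator hψ h X).trans ((quasiMeasurePreserving_of_map_le hψ h).ae_eq_comp hx)

theorem norm_compOperator_le (hψ : Measurable ψ) (h : P.map ψ ≤ c • P) :
    ‖compOperator hψ h‖ ≤ Real.sqrt c :=
  LinearMap.mkContinuous_norm_le _ (Real.sqrt_nonneg _) _

end Composition

/-! ### Transport of `P` by the flow -/

section Transport

variable {n : ℕ} {ρ : EuclideanSpace ℝ (Fin n) → ℝ}
  {F : EuclideanSpace ℝ (Fin n) → EuclideanSpace ℝ (Fin n)}

theorem densityMeasure_absolutelyContinuous : densityMeasure ρ ≪ volume :=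
  withDensity_absolutelyContinuous _ _

theorem isFiniteMeasure_densityMeasure (hρ : Integrable ρ) :
    IsFiniteMeasure (densityMeasure ρ) :=
  isFiniteMeasure_withDensity_ofReal hρ.2

theorem integral_densityMeasure (hρ : Integrable ρ) (hρ0 : 0 ≤ᵐ[volume] ρ)
    (u : EuclideanSpace ℝ (Fin n) → ℝ) :
    ∫ x, u x ∂densityMeasure ρ = ∫ x, ρ x * u x := by
  rw [densityMeasure, integral_withDensity_eq_integral_toReal_smul₀
    hρ.aestronglyMeasurable.aemeasurable.ennreal_ofReal (by simp)]
  refine integral_congr_ae ?_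
  filter_upwards [hρ0] with x hx
  simp [ENNReal.toReal_ofReal hx]

/-- Since `div(ρF)` vanishes almost everywhere where `ρ` does, integration by parts takes the form
`∫ F · ∇f dP = - ∫ ρ⁻¹ div(ρF) f dP`. -/
theorem integral_fderiv_densityMeasure (hρF : ∀ i, MemW11 fun x => (ρ x • F x) i)
    (hρ : Integrable ρ) (hρ0 : 0 ≤ᵐ[volume] ρ) (hF : Continuous F)
    {f : EuclideanSpace ℝ (Fin n) → ℝ} {L : NNReal} (hf : LipschitzWith L f)
    (hc : HasCompactSupport f) :
    ∫ x, fderiv ℝ f x (F x) ∂densityMeasure ρ = - ∫ x, logDiv ρ F x * f x ∂densityMeasure ρ := by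
  rw [integral_densityMeasure hρ hρ0, integral_densityMeasure hρ hρ0,
    integral_mul_fderiv_eq_neg_weakDiv hρF hρ hF hf hc]
  congr 1
  refine integral_congr_ae ?_
  filter_upwards [ae_weakDiv_eq_zero hρF] with x hx
  by_cases h0 : ρ x = 0
  · simp [hx h0, h0]
  · simp only [logDiv]
    field_simp

variable {φ : Flow ℝ (EuclideanSpace ℝ (Fin n))}

theorem hasDerivAt_comp_flow (hφ : ∀ x t, HasDerivAt (fun s => φ s x) (F (φ t x)) t)
    {u : EuclideanSpace ℝ (Fin n) → ℝ} (hu : ContDiff ℝ 1 u) (x : EuclideanSpace ℝ (Fin n))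
    (t : ℝ) : HasDerivAt (fun s => u (φ s x)) (fderiv ℝ u (φ t x) (F (φ t x))) t :=
  (hu.differentiable one_ne_zero (φ t x)).hasFDerivAt.comp_hasDerivAt t (hφ x t)

/-- `F · ∇` commutes with composition by the flow. -/
theorem fderiv_comp_flow (hφ : ∀ x t, HasDerivAt (fun s => φ s x) (F (φ t x)) t)
    {u : EuclideanSpace ℝ (Fin n) → ℝ} (hu : ContDiff ℝ 1 u) {x : EuclideanSpace ℝ (Fin n)}
    {t : ℝ} (hd : DifferentiableAt ℝ (fun y => u (φ t y)) x) :
    fderiv ℝ (fun y => u (φ t y)) x (F x) = fderiv ℝ u (φ t x) (F (φ t x)) := by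
  have h1 : HasDerivAt (fun s => u (φ t (φ s x))) (fderiv ℝ (fun y => u (φ t y)) x (F x)) 0 := by
    have h0 := hφ x 0
    rw [φ.map_zero_apply] at h0
    have hd' : HasFDerivAt (fun y => u (φ t y)) (fderiv ℝ (fun y => u (φ t y)) x) (φ 0 x) := by
      rw [φ.map_zero_apply]; exact hd.hasFDerivAt
    exact HasFDerivAt.comp_hasDerivAt (f := fun s => φ s x) 0 hd' h0
  have h2 : HasDerivAt (fun s => u (φ (t + s) x)) (fderiv ℝ u (φ t x) (F (φ t x))) 0 := by
    have := hasDerivAt_comp_flow hφ hu x (t + 0)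
    rw [add_zero] at this
    have h3 : HasDerivAt (fun s => u (φ s x)) (fderiv ℝ u (φ t x) (F (φ t x))) (t + 0) := by
      rwa [add_zero]
    exact h3.comp_const_add t 0
  simp only [φ.map_add] at h2
  exact h1.unique h2

theorem hasCompactSupport_comp_flow {u : EuclideanSpace ℝ (Fin n) → ℝ} (hc : HasCompactSupport u)
    (t : ℝ) : HasCompactSupport fun x => u (φ t x) :=
  hc.comp_homeomorph (φ.toHomeomorph t)

theorem ae_abs_logDiv_le (hω : eLpNorm (logDiv ρ F) ∞ (densityMeasure ρ) < ∞) :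
    ∀ᵐ x ∂densityMeasure ρ,
      |logDiv ρ F x| ≤ (eLpNorm (logDiv ρ F) ∞ (densityMeasure ρ)).toReal := by
  filter_upwards [ae_le_eLpNormEssSup (f := logDiv ρ F) (μ := densityMeasure ρ)] with x hx
  rw [← eLpNorm_exponent_top] at hx
  have := ENNReal.toReal_mono hω.ne hx
  simpa using this

theorem exists_bound_fderiv_apply (hF : Continuous F) {u : EuclideanSpace ℝ (Fin n) → ℝ}
    (hu : ContDiff ℝ 1 u) (hc : HasCompactSupport u) : ∃ C, ∀ x, |fderiv ℝ u x (F x)| ≤ C := by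
  refine exists_bound_of_hasCompactSupport
    ((hu.continuous_fderiv one_ne_zero).clm_apply hF) ?_
  refine (hc.fderiv (𝕜 := ℝ)).mono fun x hx h0 => hx ?_
  simp only [h0, _root_.zero_apply]

/-- The transport equation in weak form: the derivative under the integral sign is
`∫ F · ∇(u ∘ φₜ) dP`, which is integrated by parts although `u ∘ φₜ` is merely Lipschitz. -/
theorem hasDerivAt_integral_comp_flow {K : NNReal} (hFL : LipschitzWith K F)
    (hφ : ∀ x t, HasDerivAt (fun s => φ s x) (F (φ t x)) t)
    (hρF : ∀ i, MemW11 fun x => (ρ x • F x) i) (hρ : Integrable ρ) (hρ0 : 0 ≤ᵐ[volume] ρ)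
    {u : EuclideanSpace ℝ (Fin n) → ℝ} (hu : ContDiff ℝ 1 u) (hc : HasCompactSupport u) (t : ℝ) :
    HasDerivAt (fun s => ∫ x, u (φ s x) ∂densityMeasure ρ)
      (- ∫ x, logDiv ρ F x * u (φ t x) ∂densityMeasure ρ) t := by
  have := isFiniteMeasure_densityMeasure hρ
  obtain ⟨L, hL⟩ := hu.lipschitzWith_of_hasCompactSupport hc one_ne_zero
  obtain ⟨C, hC⟩ := exists_bound_fderiv_apply hFL.continuous hu hc
  have hcont : ∀ s, Continuous fun x => u (φ s x) := fun s =>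
    hu.continuous.comp (φ.continuous_toFun s)
  have hder := (hasDerivAt_integral_of_dominated_loc_of_deriv_le (μ := densityMeasure ρ)
    (F := fun s x => u (φ s x)) (F' := fun s x => fderiv ℝ u (φ s x) (F (φ s x)))
    (bound := fun _ => C) (s := univ) (x₀ := t) univ_mem
    (Eventually.of_forall fun s => (hcont s).aestronglyMeasurable)
    ((hcont t).integrable_of_hasCompactSupport (hasCompactSupport_comp_flow hc t))
    ((((hu.continuous_fderiv one_ne_zero).clm_apply hFL.continuous).comp
      (φ.continuous_toFun t)).aestronglyMeasurable)
    (ae_of_all _ fun x s _ => hC _) (integrable_const _)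
    (ae_of_all _ fun x s _ => hasDerivAt_comp_flow hφ hu x s)).2
  have hLt : LipschitzWith _ fun x => u (φ t x) := hL.comp (lipschitzWith_flow hFL hφ t)
  refine hder.congr_deriv ?_
  rw [← integral_fderiv_densityMeasure hρF hρ hρ0 hFL.continuous hLt
    (hasCompactSupport_comp_flow hc t)]
  refine integral_congr_ae ?_
  filter_upwards [densityMeasure_absolutelyContinuous.ae_le hLt.ae_differentiableAt] with x hx
  exact (fderiv_comp_flow hφ hu hx).symm

/-- The image measure of `P` under the flow satisfies `(φₜ)_* P ≤ exp(‖ρ⁻¹ div(ρF)‖_∞ |t|) P`. -/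
theorem map_flow_le {K : NNReal} (hFL : LipschitzWith K F)
    (hφ : ∀ x t, HasDerivAt (fun s => φ s x) (F (φ t x)) t)
    (hρF : ∀ i, MemW11 fun x => (ρ x • F x) i) (hρ : Integrable ρ) (hρ0 : 0 ≤ᵐ[volume] ρ)
    (hω : eLpNorm (logDiv ρ F) ∞ (densityMeasure ρ) < ∞) (t : ℝ) :
    (densityMeasure ρ).map (φ t) ≤
      (Real.exp ((eLpNorm (logDiv ρ F) ∞ (densityMeasure ρ)).toReal * |t|)).toNNReal •
        densityMeasure ρ := by
  have := isFiniteMeasure_densityMeasure hρ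
  set k : ℝ := (eLpNorm (logDiv ρ F) ∞ (densityMeasure ρ)).toReal with hk
  refine measure_le_smul_of_forall_integral_le fun u hu hc hu0 => ?_
  rw [integral_map (φ.continuous_toFun t).aemeasurable hu.continuous.aestronglyMeasurable,
    Real.coe_toNNReal _ (Real.exp_pos _).le]
  set h : ℝ → ℝ := fun s => ∫ x, u (φ s x) ∂densityMeasure ρ with hh
  set h' : ℝ → ℝ := fun s => - ∫ x, logDiv ρ F x * u (φ s x) ∂densityMeasure ρ with hh'
  have hd : ∀ s, HasDerivAt h (h' s) s := fun s =>
    hasDerivAt_integral_comp_flow hFL hφ hρF hρ hρ0 hu hc s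
  have hb : ∀ s, |h' s| ≤ k * h s := by
    intro s
    rw [hh', abs_neg, hh, ← integral_const_mul, ← Real.norm_eq_abs]
    have hi : Integrable (fun x => u (φ s x)) (densityMeasure ρ) :=
      (hu.continuous.comp (φ.continuous_toFun s)).integrable_of_hasCompactSupport
        (hasCompactSupport_comp_flow hc s)
    refine norm_integral_le_of_norm_le (hi.const_mul k) ?_
    filter_upwards [ae_abs_logDiv_le hω] with x hx
    rw [norm_mul, Real.norm_eq_abs, Real.norm_eq_abs, abs_of_nonneg (hu0 _)]
    exact mul_le_mul_of_nonneg_right hx (hu0 _)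
  have h00 : h 0 = ∫ x, u x ∂densityMeasure ρ := by simp [hh]
  rw [← h00]
  change h t ≤ _
  rcases le_total 0 t with ht | ht
  · have hanti : Antitone fun s => Real.exp (-(k * s)) * h s := by
      refine antitone_of_hasDerivAt_nonpos
        (fun s => ((((hasDerivAt_id s).const_mul k).fun_neg).exp.mul (hd s))) fun s => ?_
      have h1 := (abs_le.1 (hb s)).2
      have h2 := mul_nonneg (Real.exp_pos (-(k * s))).le (sub_nonneg.2 h1)
      simp only [id, Pi.zero_apply]
      linarith
    have := hanti ht
    simp only [mul_zero, neg_zero, Real.exp_zero, one_mul, Real.exp_neg] at this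
    rw [inv_mul_le_iff₀ (Real.exp_pos _)] at this
    rwa [abs_of_nonneg ht]
  · have hmono : Monotone fun s => Real.exp (k * s) * h s := by
      refine monotone_of_hasDerivAt_nonneg
        (fun s => ((((hasDerivAt_id s).const_mul k)).exp.mul (hd s))) fun s => ?_
      have h1 := (abs_le.1 (hb s)).1
      have h2 := mul_nonneg (Real.exp_pos (k * s)).le (sub_nonneg.2 h1)
      simp only [id, Pi.zero_apply]
      linarith
    have := hmono ht
    simp only [mul_zero, Real.exp_zero, one_mul] at this
    rw [abs_of_nonpos ht, mul_neg, Real.exp_neg]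
    rwa [le_inv_mul_iff₀ (Real.exp_pos _)]

end Transport

end TransportOfMeasure

/-! ### The group of composition operators and its generator -/

section GroupOfFlow

open Set

variable {n : ℕ} {F : EuclideanSpace ℝ (Fin n) → EuclideanSpace ℝ (Fin n)}
  {P : Measure (EuclideanSpace ℝ (Fin n))} [IsFiniteMeasure P]

/-- The classes of functions in `C¹_c(ℝⁿ)` are dense in `L²(P)`. -/
theorem dense_fst_advectionGraph (hF : Continuous F) :
    Dense (Prod.fst '' (advectionGraph F P : Set (Lp ℝ 2 P × Lp ℝ 2 P))) := by
  set S := Prod.fst '' (advectionGraph F P : Set (Lp ℝ 2 P × Lp ℝ 2 P)) with hS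
  have hcc : ∀ (u : EuclideanSpace ℝ (Fin n) → ℝ) (hm : MemLp u 2 P), Continuous u →
      HasCompactSupport u → hm.toLp u ∈ closure S := by
    intro u hm hu hc
    obtain ⟨R, hR⟩ := exists_radius_of_hasCompactSupport hc
    obtain ⟨C, hC⟩ := exists_bound_of_hasCompactSupport hu hc
    have hsm : ∀ k, ContDiff ℝ 1 (mollify k u) := fun k =>
      (contDiff_mollify hu.locallyIntegrable k).of_le (by exact_mod_cast le_top)
    have hcs : ∀ k, HasCompactSupport (mollify k u) := fun k =>
      hasCompactSupport_of_forall_norm fun x hx => mollify_eq_zero hR k hx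
    have hmk : ∀ k, MemLp (mollify k u) 2 P := fun k =>
      (hsm k).continuous.memLp_of_hasCompactSupport (hcs k)
    refine mem_closure_of_tendsto (tendsto_toLp_of_bounded (l := atTop) hmk hm
      (fun k x => abs_mollify_le hC k x) (ae_of_all _ fun x => tendsto_mollify hu x))
      (Eventually.of_forall fun k => ?_)
    obtain ⟨p, hp, hp1, -⟩ := exists_mem_advectionGraph hF P (hsm k) (hcs k)
    exact ⟨p, hp, Lp.ext (hp1.trans (hmk k).coeFn_toLp.symm)⟩
  intro X
  rw [← closure_closure, EMetric.mem_closure_iff]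
  intro ε hε
  obtain ⟨δ, hδ0, hδ⟩ := exists_between hε
  obtain ⟨u, hc, hle, hu, hm⟩ := (Lp.memLp X).exists_hasCompactSupport_eLpNorm_sub_le
    (by simp) hδ0.ne'
  refine ⟨hm.toLp u, hcc u hm hu hc, ?_⟩
  rw [← Lp.toLp_coeFn X (Lp.memLp X), Lp.edist_toLp_toLp]
  exact hle.trans_lt hδ

variable {φ : Flow ℝ (EuclideanSpace ℝ (Fin n))} {U : ℝ → Lp ℝ 2 P →L[ℝ] Lp ℝ 2 P}

theorem continuous_orbit_of_mem_advectionGraph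
    (hU : ∀ t (X : Lp ℝ 2 P) (x : EuclideanSpace ℝ (Fin n) → ℝ), X =ᵐ[P] x →
      U t X =ᵐ[P] fun ω => x (φ t ω))
    {p : Lp ℝ 2 P × Lp ℝ 2 P} (hp : p ∈ advectionGraph F P) : Continuous fun t => U t p.1 := by
  obtain ⟨x, hx, cx, h1, -⟩ := hp
  obtain ⟨C, hC⟩ := exists_bound_of_hasCompactSupport hx.continuous cx
  have hm : ∀ t, MemLp (fun ω => x (φ t ω)) 2 P := fun t =>
    (memLp_congr_ae (hU t _ _ h1)).1 (Lp.memLp _)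
  have he : ∀ t, U t p.1 = (hm t).toLp _ := fun t =>
    Lp.ext ((hU t _ _ h1).trans (hm t).coeFn_toLp.symm)
  simp only [he]
  refine continuous_iff_continuousAt.2 fun t => ?_
  refine tendsto_toLp_of_bounded hm (hm t) (fun s ω => hC _) (ae_of_all _ fun ω => ?_)
  exact (hx.continuous.comp (φ.continuous continuous_id continuous_const)).tendsto t

/-- The operator `F · ∇` on `C¹_c(ℝⁿ)` is a restriction of the generator: the difference quotients
of `t ↦ x ∘ φₜ` converge pointwise and are bounded by the supremum of `|F · ∇x|`. -/
theorem hasDerivAt_orbit_of_mem_advectionGraph (hF : Continuous F)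
    (hφ : ∀ x t, HasDerivAt (fun s => φ s x) (F (φ t x)) t)
    (hU : ∀ t (X : Lp ℝ 2 P) (x : EuclideanSpace ℝ (Fin n) → ℝ), X =ᵐ[P] x →
      U t X =ᵐ[P] fun ω => x (φ t ω))
    {p : Lp ℝ 2 P × Lp ℝ 2 P} (hp : p ∈ advectionGraph F P) :
    HasDerivAt (fun t => U t p.1) p.2 0 := by
  obtain ⟨x, hx, cx, h1, h2⟩ := hp
  obtain ⟨C, hC⟩ := exists_bound_fderiv_apply hF hx cx
  have hC0 : 0 ≤ C := (abs_nonneg _).trans (hC 0)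
  have hm : ∀ t, MemLp (fun ω => x (φ t ω)) 2 P := fun t =>
    (memLp_congr_ae (hU t _ _ h1)).1 (Lp.memLp _)
  have hm2 : MemLp (fun ω => fderiv ℝ x ω (F ω)) 2 P := (memLp_congr_ae h2).1 (Lp.memLp _)
  have hq : ∀ t : ℝ, MemLp (fun ω => t⁻¹ * (x (φ (0 + t) ω) - x (φ 0 ω))) 2 P := fun t =>
    ((hm (0 + t)).sub (hm 0)).const_mul t⁻¹
  have he : ∀ t : ℝ, t⁻¹ • (U (0 + t) p.1 - U 0 p.1) = (hq t).toLp _ := by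
    intro t
    refine Lp.ext ?_
    filter_upwards [Lp.coeFn_smul t⁻¹ (U (0 + t) p.1 - U 0 p.1),
      Lp.coeFn_sub (U (0 + t) p.1) (U 0 p.1), hU (0 + t) _ _ h1, hU 0 _ _ h1,
      (hq t).coeFn_toLp] with ω e1 e2 e3 e4 e5
    rw [e1, e5, Pi.smul_apply, e2, Pi.sub_apply, e3, e4, smul_eq_mul]
  have he2 : p.2 = hm2.toLp _ := Lp.ext (h2.trans hm2.coeFn_toLp.symm)
  rw [hasDerivAt_iff_tendsto_slope_zero]
  simp only [he]
  rw [he2]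
  have hd : ∀ ω s, HasDerivAt (fun s => x (φ s ω)) (fderiv ℝ x (φ s ω) (F (φ s ω))) s :=
    fun ω s => hasDerivAt_comp_flow hφ hx ω s
  refine tendsto_toLp_of_bounded (C := C) hq hm2 (fun t ω => ?_) (ae_of_all _ fun ω => ?_)
  · have hmv := Convex.norm_image_sub_le_of_norm_hasDerivWithin_le (f := fun s => x (φ s ω))
      (s := univ) (C := C) (fun s _ => (hd ω s).hasDerivWithinAt) (fun s _ => hC _) convex_univ
      (mem_univ 0) (mem_univ (0 + t))
    rw [Real.norm_eq_abs, Real.norm_eq_abs, zero_add, sub_zero] at hmv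
    rw [abs_mul, abs_inv, zero_add]
    rcases eq_or_ne t 0 with rfl | ht
    · simpa using hC0
    · rw [inv_mul_le_iff₀ (abs_pos.2 ht), mul_comm]
      exact hmv
  · have := (hasDerivAt_iff_tendsto_slope_zero.1 (hd ω 0))
    simpa using this

/-- For `x` in `C¹_c(ℝⁿ)`, the orbit of `(x, F · ∇x)` stays in the closure of the graph of `F · ∇`,
since `x ∘ φₜ` is Lipschitz of compact support and `F · ∇(x ∘ φₜ) = (F · ∇x) ∘ φₜ` almost
everywhere. -/
theorem orbit_mem_closure_advectionGraph {K : NNReal} (hF : LipschitzWith K F)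
    (hP : P ≪ volume) (hφ : ∀ x t, HasDerivAt (fun s => φ s x) (F (φ t x)) t)
    (hU : ∀ t (X : Lp ℝ 2 P) (x : EuclideanSpace ℝ (Fin n) → ℝ), X =ᵐ[P] x →
      U t X =ᵐ[P] fun ω => x (φ t ω))
    {p : Lp ℝ 2 P × Lp ℝ 2 P} (hp : p ∈ advectionGraph F P) (t : ℝ) :
    (U t p.1, U t p.2) ∈ (advectionGraph F P).topologicalClosure := by
  obtain ⟨x, hx, cx, h1, h2⟩ := hp
  obtain ⟨L, hL⟩ := hx.lipschitzWith_of_hasCompactSupport cx one_ne_zero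
  have hLt : LipschitzWith _ fun ω => x (φ t ω) := hL.comp (lipschitzWith_flow hF hφ t)
  refine mem_closure_advectionGraph hF.continuous hP hLt (hasCompactSupport_comp_flow cx t)
    (hU t _ _ h1) ((hU t _ _ h2).trans ?_)
  filter_upwards [hP.ae_le hLt.ae_differentiableAt] with ω hω
  exact (fderiv_comp_flow hφ hx hω).symm

end GroupOfFlow

end Koopman

theorem mainTheorem11 {n : ℕ}
    (ρ : EuclideanSpace ℝ (Fin n) → ℝ)
    (hρ_int : Integrable ρ volume) (hρ_nonneg : 0 ≤ᵐ[volume] ρ) (hρ_one : ∫ x, ρ x = 1)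
    (F : EuclideanSpace ℝ (Fin n) → EuclideanSpace ℝ (Fin n))
    (hF : ContDiff ℝ 1 F) (hF_bdd : ∃ M : ℝ, ∀ x, ‖fderiv ℝ F x‖ ≤ M)
    (hρF : ∀ i, Koopman.MemW11 fun x => (ρ x • F x) i)
    (hω₀ : eLpNorm (Koopman.logDiv ρ F) ∞ (Koopman.densityMeasure ρ) < ∞) :
    -- the flow of `F`
    ∃ φ : Flow ℝ (EuclideanSpace ℝ (Fin n)),
      (∀ x t, HasDerivAt (fun s => φ s x) (F (φ t x)) t) ∧
    -- the group generated by the closure of `F · ∇`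
    ∃ U : ℝ → Lp ℝ 2 (Koopman.densityMeasure ρ) →L[ℝ] Lp ℝ 2 (Koopman.densityMeasure ρ),
      Koopman.IsC0Group U ∧
      (Koopman.advection F (Koopman.densityMeasure ρ)).IsClosable ∧
      (Koopman.advection F (Koopman.densityMeasure ρ)).closure = Koopman.generator U ∧
      (∀ t, ‖U t‖ ≤ Real.exp
        ((1 / 2 : ℝ) * (eLpNorm (Koopman.logDiv ρ F) ∞ (Koopman.densityMeasure ρ)).toReal * |t|)) ∧
      (∀ x : EuclideanSpace ℝ (Fin n) → ℝ, ContDiff ℝ 1 x → HasCompactSupport x →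
        ∃ hx : MemLp x 2 (Koopman.densityMeasure ρ),
          ∀ t, U t (hx.toLp x) =ᵐ[Koopman.densityMeasure ρ] fun ω => x (φ t ω)) ∧
      (Koopman.weakDiv (fun x => ρ x • F x) =ᵐ[volume] 0 →
        (∀ t, Isometry (U t)) ∧
        (∀ t, MeasurePreserving (φ t) (Koopman.densityMeasure ρ) (Koopman.densityMeasure ρ)) ∧
        (∀ (x : EuclideanSpace ℝ (Fin n) → ℝ) (hx : MemLp x 2 (Koopman.densityMeasure ρ)) (t : ℝ),
          U t (hx.toLp x) =ᵐ[Koopman.densityMeasure ρ] fun ω => x (φ t ω))) := by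
  obtain ⟨M, hM⟩ := hF_bdd
  have hFL : LipschitzWith M.toNNReal F :=
    lipschitzWith_of_nnnorm_fderiv_le (hF.differentiable one_ne_zero) fun x =>
      NNReal.le_toNNReal_of_coe_le (hM x)
  obtain ⟨φ, hφ⟩ := Koopman.exists_flow_of_lipschitzWith hFL hF
  have := Koopman.isFiniteMeasure_densityMeasure hρ_int
  set P := Koopman.densityMeasure ρ with hP
  set k : ℝ := (eLpNorm (Koopman.logDiv ρ F) ∞ P).toReal with hk
  have hPac : P ≪ volume := Koopman.densityMeasure_absolutelyContinuous
  have hmap : ∀ t, P.map (φ t) ≤ (Real.exp (k * |t|)).toNNReal • P :=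
    Koopman.map_flow_le hFL hφ hρF hρ_int hρ_nonneg hω₀
  have hφm : ∀ t, Measurable (φ t) := fun t => (φ.continuous_toFun t).measurable
  let U : ℝ → Lp ℝ 2 P →L[ℝ] Lp ℝ 2 P := fun t => Koopman.compOperator (hφm t) (hmap t)
  have hU : ∀ t (X : Lp ℝ 2 P) (x : EuclideanSpace ℝ (Fin n) → ℝ), X =ᵐ[P] x →
      U t X =ᵐ[P] fun ω => x (φ t ω) := fun t X x h =>
    Koopman.compOperator_ae_eq (hφm t) (hmap t) h
  have hUb : ∀ t, ‖U t‖ ≤ Real.exp ((1 / 2 : ℝ) * k * |t|) := fun t => by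
    refine (Koopman.norm_compOperator_le (hφm t) (hmap t)).trans_eq ?_
    rw [Real.coe_toNNReal _ (Real.exp_pos _).le, ← Real.exp_half]
    congr 1
    ring
  have hcb : Continuous fun t : ℝ => Real.exp ((1 / 2 : ℝ) * k * |t|) := by fun_prop
  have hdense := Koopman.dense_fst_advectionGraph (P := P) hF.continuous
  have hgroup : Koopman.IsC0Group U := by
    refine ⟨?_, fun s t => ?_, Koopman.continuous_orbit_of_dense hcb hUb hdense ?_⟩
    · ext1 X
      refine Lp.ext ?_
      filter_upwards [hU 0 X X (ae_eq_refl _)] with ω hω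
      rw [hω, φ.map_zero_apply]
      rfl
    · ext1 X
      refine Lp.ext ?_
      filter_upwards [hU (s + t) X X (ae_eq_refl _),
        hU s (U t X) _ (hU t X X (ae_eq_refl _))] with ω h1 h2
      rw [h1, mul_apply_eq_comp, h2, add_comm, φ.map_add]
    · rintro _ ⟨p, hp, rfl⟩
      exact Koopman.continuous_orbit_of_mem_advectionGraph hU hp
  have hgraph := Koopman.advection_graph F hPac
  have hclosed := hgroup.isClosed_generator hcb hUb
  have hle : Koopman.advectionGraph F P ≤ (Koopman.generator U).graph := fun p hp =>
    Koopman.mem_graph_generator.2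
      (Koopman.hasDerivAt_orbit_of_mem_advectionGraph hF.continuous hφ hU hp)
  have hclosable : (Koopman.advection F P).IsClosable :=
    hclosed.isClosable.leIsClosable (LinearPMap.le_of_le_graph (hgraph.trans_le hle))
  refine ⟨φ, hφ, U, hgroup, hclosable, ?_, hUb, fun x hx cx => ?_, fun hdiv => ?_⟩
  · refine LinearPMap.eq_of_eq_graph ?_
    rw [← hclosable.graph_closure_eq_closure_graph, hgraph]
    refine le_antisymm (Submodule.topologicalClosure_minimal _ hle hclosed) fun p hp => ?_
    exact hgroup.mem_of_hasDerivAt hcb hUb (Submodule.isClosed_topologicalClosure _)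
      (S := Koopman.advectionGraph F P)
      (fun p hp => Koopman.hasDerivAt_orbit_of_mem_advectionGraph hF.continuous hφ hU hp)
      (fun p hp s => Koopman.orbit_mem_closure_advectionGraph hFL hPac hφ hU hp s) hdense
      (Koopman.mem_graph_generator.1 hp)
  · have hm : MemLp x 2 P := hx.continuous.memLp_of_hasCompactSupport cx
    exact ⟨hm, fun t => hU t _ _ hm.coeFn_toLp⟩
  · -- without divergence the growth rate vanishes, and all bounds become invariances because
    -- they hold in both time directions
    have hk0 : k = 0 := by
      have : Koopman.logDiv ρ F =ᵐ[P] 0 := by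
        filter_upwards [hPac.ae_le hdiv] with x hx
        simp [Koopman.logDiv, hx]
      rw [hk, eLpNorm_congr_ae this, eLpNorm_zero, ENNReal.toReal_zero]
    refine ⟨fun t => ?_, fun t => ⟨hφm t, ?_⟩, fun x hx t => hU t _ _ hx.coeFn_toLp⟩
    · have h1 : ∀ s X, ‖U s X‖ ≤ ‖X‖ := fun s X => by
        have := (U s).le_of_opNorm_le (hUb s) X
        simpa [hk0] using this
      refine AddMonoidHomClass.isometry_of_norm (U t) fun X => le_antisymm (h1 t X) ?_
      have h2 : U (-t) (U t X) = X := by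
        have := congrArg (fun A => A X) (hgroup.map_add (-t) t)
        rw [neg_add_cancel, hgroup.map_zero] at this
        exact this.symm
      calc ‖X‖ = ‖U (-t) (U t X)‖ := by rw [h2]
        _ ≤ ‖U t X‖ := h1 _ _
    · have h1 : ∀ s, P.map (φ s) ≤ P := fun s => by simpa [hk0] using hmap s
      refine le_antisymm (h1 t) ?_
      calc P = (P.map (φ (-t))).map (φ t) := by
            rw [Measure.map_map (hφm t) (hφm (-t))]
            have : φ t ∘ φ (-t) = id := by
              ext1 x
              rw [Function.comp_apply, ← φ.map_add, add_neg_cancel, φ.map_zero]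
            rw [this, Measure.map_id]
        _ ≤ P.map (φ t) := Measure.map_mono (h1 (-t)) (hφm t)
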